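/- Let $q$ be an odd prime power, and let $\overline{\mathcal C}$ be a non-degenerate conic of $\mathrm{PG}(2,q^2)$ that is tangent to a line $\ell_\infty$ at a point $P_\infty$ (a line is tangent to $\overline{\mathcal C}$ if it meets $\overline{\mathcal C}$ in exactly one point). Put $\mathcal C=\overline{\mathcal C}\setminus\{P_\infty\}$, and call the points not on $\ell_\infty$ affine. A Baer subplane is a subplane of order $q$; it is secant to $\ell_\infty$ if it meets $\ell_\infty$ in $q+1$ points. A $\mathcal C$-plane is a Baer subplane of $\mathrm{PG}(2,q^2)$ that is secant to $\ell_\infty$ and meets $\mathcal C$ in exactly $q$ points. A point not on $\overline{\mathcal C}$ is interior if it lies on no tangent line of $\overline{\mathcal C}$, and exterior if it lies on exactly two. Then: 1. Each $\mathcal C$-plane meets $\mathcal C$ in a $q$-arc (a set of $q$ points, no three collinear). Further, if a Baer subplane secant to $\ell_\infty$ meets $\mathcal C$ in more than four points, it is a $\mathcal C$-plane. If moreover $q>3$, then: 2. Every two distinct points of $\mathcal C$ lie together in exactly one $\mathcal C$-plane. 3. Each affine point is a point of $\mathcal C$, an interior point of $\overline{\mathcal C}$ or an exterior point of $\overline{\mathcal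 C}$. An affine point is an interior point if and only if it lies on no $\mathcal C$-plane, and it is an exterior point if and only if it lies on exactly two $\mathcal C$-planes. -/

import Mathlib

open scoped LinearAlgebra.Projectivization Matrix

/-- The point set of the Desarguesian projective plane `PG(2, K)`: the one-dimensional subspaces
of `K³`. -/
abbrev PGPoint (K : Type*) [Field K] : Type _ := ℙ K (Fin 3 → K)

/-- A set of points of `PG(2, K)` is a line if it is the zero locus of a nonzero linear form.
The condition does not depend on the representative of the point. -/
def IsLine {K : Type*} [Field K] (l : Set (PGPoint K)) : Prop :=
  ∃ u : Fin 3 → K, u ≠ 0 ∧ l = {P | u ⬝ᵥ P.rep = 0}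

/-- Three points are collinear if some line contains all of them. -/
def AreCollinear {K : Type*} [Field K] (A B C : PGPoint K) : Prop :=
  ∃ l : Set (PGPoint K), IsLine l ∧ A ∈ l ∧ B ∈ l ∧ C ∈ l

/-- A `k`-arc: a set of `k` points, no three of which are collinear. -/
def IsArc {K : Type*} [Field K] (k : ℕ) (S : Set (PGPoint K)) : Prop :=
  S.Finite ∧ S.ncard = k ∧
    ∀ A ∈ S, ∀ B ∈ S, ∀ C ∈ S, A ≠ B → A ≠ C → B ≠ C → ¬ AreCollinear A B C

/-- A non-degenerate conic: the zero locus of a ternary quadratic form whose polar bilinear form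
is nondegenerate (in odd characteristic this is non-degeneracy of the quadratic form). -/
def IsNondegenerateConic {K : Type*} [Field K] (O : Set (PGPoint K)) : Prop :=
  ∃ Q : QuadraticForm K (Fin 3 → K),
    LinearMap.BilinForm.Nondegenerate Q.polarBilin ∧ O = {P | Q P.rep = 0}

/-- The line `l` is tangent to the conic `O` at the point `P`: it meets `O` in exactly `P`. -/
def IsTangentAt {K : Type*} [Field K] (O l : Set (PGPoint K)) (P : PGPoint K) : Prop :=
  IsLine l ∧ O ∩ l = {P}

/-- The tangent lines of `O` that pass through the point `X`. -/
def tangentsThrough {K : Type*} [Field K] (O : Set (PGPoint K)) (X : PGPoint K) :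
    Set (Set (PGPoint K)) :=
  {l | (∃ P, IsTangentAt O l P) ∧ X ∈ l}

/-- An interior point of a conic: a point off the conic that lies on no tangent line. -/
def IsInteriorPoint {K : Type*} [Field K] (O : Set (PGPoint K)) (X : PGPoint K) : Prop :=
  X ∉ O ∧ tangentsThrough O X = ∅

/-- An exterior point of a conic: a point off the conic that lies on exactly two tangent lines. -/
def IsExteriorPoint {K : Type*} [Field K] (O : Set (PGPoint K)) (X : PGPoint K) : Prop :=
  X ∉ O ∧ (tangentsThrough O X).encard = 2

/-- `l` is a line of the plane that contains at least two points of `B`. -/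
def IsLineOf {K : Type*} [Field K] (B l : Set (PGPoint K)) : Prop :=
  IsLine l ∧ ∃ X ∈ B ∩ l, ∃ Y ∈ B ∩ l, X ≠ Y

/-- `B` is (the point set of) a subplane of order `q` of `PG(2, K)`: with the lines joining two of
its points, and incidence inherited from `PG(2, K)`, it is a projective plane of order `q`.
(That two points of `B` are joined by a unique line of the subplane is inherited.) -/
structure IsSubplaneOfOrder {K : Type*} [Field K] (q : ℕ) (B : Set (PGPoint K)) : Prop where
  /-- Two distinct lines of the subplane meet in a point of the subplane. -/
  meet : ∀ l m : Set (PGPoint K), IsLineOf B l → IsLineOf B m → l ≠ m → ∃ X ∈ B, X ∈ l ∧ X ∈ m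
  /-- The subplane contains a quadrangle. -/
  quadrangle : ∃ P ∈ B, ∃ Q ∈ B, ∃ R ∈ B, ∃ S ∈ B, ¬ AreCollinear P Q R ∧ ¬ AreCollinear P Q S ∧
    ¬ AreCollinear P R S ∧ ¬ AreCollinear Q R S
  /-- Each line of the subplane contains exactly `q + 1` points of the subplane. -/
  order : ∀ l : Set (PGPoint K), IsLineOf B l → (B ∩ l).encard = q + 1

/-- A Baer subplane of `PG(2, q²)`: a subplane of order `q`, where `q² = |K|`. -/
def IsBaerSubplane {K : Type*} [Field K] (q : ℕ) (B : Set (PGPoint K)) : Prop :=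
  Nat.card K = q ^ 2 ∧ IsSubplaneOfOrder q B

/-- A Baer subplane that is secant to the line `l`, that is, meets it in `q + 1` points. -/
def IsBaerSecantTo {K : Type*} [Field K] (q : ℕ) (l B : Set (PGPoint K)) : Prop :=
  IsBaerSubplane q B ∧ (B ∩ l).encard = q + 1

/-- A `C`-plane: a Baer subplane secant to the line `linf` that meets `C` in exactly `q`
points. -/
def IsCPlane {K : Type*} [Field K] (q : ℕ) (linf C B : Set (PGPoint K)) : Prop :=
  IsBaerSecantTo q linf B ∧ (B ∩ C).encard = q

/-!
In suitable coordinates the conic is the parabola `y = x²` and `ℓ∞` is the line at infinity. Let `F`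
be the subfield of order `q` of the field `K` of order `q²`. A Baer subplane that is secant to the
line at infinity is then an affine image of the plane with coordinates in `F`: intersecting lines
shows that the abscissas of its points on a coordinate axis form a subfield, of order `q`
(`IsSubplaneOfOrder.exists_eq_subplaneOver`), and such a subfield is unique
(`Subfield.mem_iff_pow_eq`).

The key point is that a Baer subplane secant to the line at infinity that contains five points of
the parabola contains precisely those with parameters in a translate `t + F * d`, and is determined
by `t` and `d` (`IsBaerSecantTo.eq_parabolaSubplane`). An affinity preserving the parabola moves two
of the points to the parameters `0` and `1`; let `s` be the parameter of a third one. The affine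
points of the subplane are the `F`-combinations of `(1, 1)` and `(s, s²)`, and if `s ∉ F`, then
comparing coefficients in the `F`-basis `1, s` of `K` leaves at most one point of the parabola
besides those with parameters `0`, `1`, `s` (`eq_of_sq_eq_of_notMem`). So five points force `s ∈ F`.

If `q > 3`, then `q ≥ 5`, so that the `C`-planes correspond to the affine lines `t + F * d` of `K`
over `F`, and two points of the parabola are in exactly one of them. The point `(x, y)` is in the
plane of `t + F * d` if and only if `x ∈ t + F * d` and `(y - x²) / d² ∈ F`
(`affinePoint_mem_parabolaSubplane`). On the other hand the tangents through `(x, y)` correspond to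
the square roots of `x² - y`. Elements of `F` are squares in `K`, so points in a `C`-plane are not
interior. If `x² - y = r²` with `r ≠ 0`, the condition on `d` says that `(d / r)² ∈ F`, and there
are two such `d` up to factors from `F`: `r` and `r * w`, where `w²` is a nonsquare of `F`.
-/

open scoped Pointwise

/-! ### Coordinates in the plane -/

section Coordinates

variable {K : Type*} [Field K]

/-- The line with coordinate vector `u`, that is, the zero locus of the form `u ⬝ᵥ ·`. -/
def lineWith (u : Fin 3 → K) : Set (PGPoint K) := {P | u ⬝ᵥ P.rep = 0}

/-- The point with affine coordinates `(x, y)` with respect to the line at infinity `z = 0`. -/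
def affinePoint (x y : K) : PGPoint K :=
  Projectivization.mk K ![x, y, 1] fun h => by simpa using congrFun h 2

/-- The point at infinity on the affine lines of slope `m`. -/
def slopePoint (m : K) : PGPoint K :=
  Projectivization.mk K ![1, m, 0] fun h => by simpa using congrFun h 0

variable (K) in
/-- The point at infinity on the vertical lines. -/
def verticalPoint : PGPoint K :=
  Projectivization.mk K ![0, 1, 0] fun h => by simpa using congrFun h 1

variable (K) in
/-- The line at infinity `z = 0`. -/
def lineAtInfinity : Set (PGPoint K) := lineWith ![0, 0, 1]

theorem mk_mem_lineWith {u v : Fin 3 → K} (hv : v ≠ 0) :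
    Projectivization.mk K v hv ∈ lineWith u ↔ u ⬝ᵥ v = 0 := by
  obtain ⟨a, ha⟩ := Projectivization.exists_smul_eq_mk_rep K v hv
  simp [lineWith, ← ha, dotProduct_smul, Units.smul_def]

theorem isLine_lineWith {u : Fin 3 → K} (hu : u ≠ 0) : IsLine (lineWith u) := ⟨u, hu, rfl⟩

theorem affinePoint_mem_lineWith {u : Fin 3 → K} {x y : K} :
    affinePoint x y ∈ lineWith u ↔ u 0 * x + u 1 * y + u 2 = 0 := by
  simp [affinePoint, mk_mem_lineWith, dotProduct, Fin.sum_univ_three]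

theorem slopePoint_mem_lineWith {u : Fin 3 → K} {m : K} :
    slopePoint m ∈ lineWith u ↔ u 0 + u 1 * m = 0 := by
  simp [slopePoint, mk_mem_lineWith, dotProduct, Fin.sum_univ_three]

theorem verticalPoint_mem_lineWith {u : Fin 3 → K} :
    verticalPoint K ∈ lineWith u ↔ u 1 = 0 := by
  simp [verticalPoint, mk_mem_lineWith, dotProduct, Fin.sum_univ_three]

@[simp] theorem affinePoint_notMem_lineAtInfinity (x y : K) :
    affinePoint x y ∉ lineAtInfinity K := by
  simp [lineAtInfinity, affinePoint_mem_lineWith]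

@[simp] theorem slopePoint_mem_lineAtInfinity (m : K) : slopePoint m ∈ lineAtInfinity K := by
  simp [lineAtInfinity, slopePoint_mem_lineWith]

@[simp] theorem verticalPoint_mem_lineAtInfinity : verticalPoint K ∈ lineAtInfinity K := by
  simp [lineAtInfinity, verticalPoint_mem_lineWith]

@[simp] theorem affinePoint_inj {x y x' y' : K} :
    affinePoint x y = affinePoint x' y' ↔ x = x' ∧ y = y' := by
  refine ⟨fun h => ?_, fun h => by rw [h.1, h.2]⟩
  obtain ⟨a, ha⟩ := (Projectivization.mk_eq_mk_iff' K _ _ _ _).1 h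
  have h2 : a = 1 := by simpa using congrFun ha 2
  subst h2
  have h0 := congrFun ha 0
  have h1 := congrFun ha 1
  simp at h0 h1
  exact ⟨h0.symm, h1.symm⟩

@[simp] theorem slopePoint_inj {m m' : K} : slopePoint m = slopePoint m' ↔ m = m' := by
  refine ⟨fun h => ?_, fun h => by rw [h]⟩
  obtain ⟨a, ha⟩ := (Projectivization.mk_eq_mk_iff' K _ _ _ _).1 h
  have h2 : a = 1 := by simpa using congrFun ha 0
  subst h2
  have h1 := congrFun ha 1
  simp at h1
  exact h1.symm

@[simp] theorem affinePoint_ne_slopePoint (x y m : K) : affinePoint x y ≠ slopePoint m :=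
  fun h => affinePoint_notMem_lineAtInfinity x y (h ▸ slopePoint_mem_lineAtInfinity m)

@[simp] theorem affinePoint_ne_verticalPoint (x y : K) : affinePoint x y ≠ verticalPoint K :=
  fun h => affinePoint_notMem_lineAtInfinity x y (h ▸ verticalPoint_mem_lineAtInfinity)

@[simp] theorem slopePoint_ne_verticalPoint (m : K) : slopePoint m ≠ verticalPoint K := by
  intro h
  obtain ⟨a, ha⟩ := (Projectivization.mk_eq_mk_iff' K _ _ _ _).1 h
  simpa using congrFun ha 0

theorem mk_eq_affinePoint {v : Fin 3 → K} (hv : v ≠ 0) (h : v 2 ≠ 0) :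
    Projectivization.mk K v hv = affinePoint (v 0 / v 2) (v 1 / v 2) := by
  refine (Projectivization.mk_eq_mk_iff' K _ _ _ _).2 ⟨v 2, ?_⟩
  ext i; fin_cases i <;> simp <;> field_simp

theorem mk_eq_slopePoint {v : Fin 3 → K} (hv : v ≠ 0) (h : v 2 = 0) (h0 : v 0 ≠ 0) :
    Projectivization.mk K v hv = slopePoint (v 1 / v 0) := by
  refine (Projectivization.mk_eq_mk_iff' K _ _ _ _).2 ⟨v 0, ?_⟩
  ext i; fin_cases i <;> simp [h]; field_simp

theorem mk_eq_verticalPoint {v : Fin 3 → K} (hv : v ≠ 0) (h : v 2 = 0) (h0 : v 0 = 0) :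
    Projectivization.mk K v hv = verticalPoint K := by
  refine (Projectivization.mk_eq_mk_iff' K _ _ _ _).2 ⟨v 1, ?_⟩
  ext i; fin_cases i <;> simp [h, h0]

theorem exists_coordinates (P : PGPoint K) :
    (∃ x y, P = affinePoint x y) ∨ (∃ m, P = slopePoint m) ∨ P = verticalPoint K := by
  induction P using Projectivization.ind with
  | h v hv =>
    by_cases h : v 2 = 0
    · by_cases h0 : v 0 = 0
      · exact .inr (.inr (mk_eq_verticalPoint hv h h0))
      · exact .inr (.inl ⟨_, mk_eq_slopePoint hv h h0⟩)
    · exact .inl ⟨_, _, mk_eq_affinePoint hv h⟩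

theorem exists_affinePoint {P : PGPoint K} (hP : P ∉ lineAtInfinity K) :
    ∃ x y, P = affinePoint x y := by
  rcases exists_coordinates P with h | ⟨m, rfl⟩ | rfl
  · exact h
  · simp at hP
  · simp at hP

theorem lineWith_eq_of_cross_eq_zero {u w : Fin 3 → K} (hu : u ≠ 0) (hw : w ≠ 0)
    (h : crossProduct u w = 0) : lineWith u = lineWith w := by
  obtain ⟨a, rfl⟩ := (Projectivization.mk_eq_mk_iff' K _ _ hu hw).1
    ((Projectivization.mk_eq_mk_iff_crossProduct_eq_zero hu hw).2 h)
  have ha : a ≠ 0 := by rintro rfl; simp at hu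
  ext P
  simp [lineWith, smul_dotProduct, ha]

/-- Two distinct points lie on only one line. -/
theorem IsLine.eq_of_mem {l m : Set (PGPoint K)} (hl : IsLine l) (hm : IsLine m)
    {X Y : PGPoint K} (hXY : X ≠ Y) (hXl : X ∈ l) (hYl : Y ∈ l) (hXm : X ∈ m) (hYm : Y ∈ m) :
    l = m := by
  obtain ⟨u, hu, rfl⟩ := hl
  obtain ⟨w, hw, rfl⟩ := hm
  have hne : crossProduct X.rep Y.rep ≠ 0 := by
    rw [Ne, ← Projectivization.mk_eq_mk_iff_crossProduct_eq_zero X.rep_nonzero Y.rep_nonzero]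
    simpa using hXY
  exact lineWith_eq_of_cross_eq_zero hu hw
    ((Configuration.ofField.crossProduct_eq_zero_of_dotProduct_eq_zero (a := u) (b := w)
      hXl hXm hYl hYm).resolve_right hne)

/-- Two distinct points `X`, `Y` are on the line with coordinate vector `X × Y`. -/
theorem IsLine.eq_lineWith_cross {l : Set (PGPoint K)} (hl : IsLine l) {v w : Fin 3 → K}
    (hv : v ≠ 0) (hw : w ≠ 0) (hne : Projectivization.mk K v hv ≠ Projectivization.mk K w hw)
    (hvl : Projectivization.mk K v hv ∈ l) (hwl : Projectivization.mk K w hw ∈ l) :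
    crossProduct v w ≠ 0 ∧ l = lineWith (crossProduct v w) := by
  have h0 : crossProduct v w ≠ 0 := by
    rwa [Ne, ← Projectivization.mk_eq_mk_iff_crossProduct_eq_zero hv hw]
  refine ⟨h0, hl.eq_of_mem (isLine_lineWith h0) hne hvl hwl ?_ ?_⟩
  · rw [mk_mem_lineWith, dotProduct_comm, dot_self_cross]
  · rw [mk_mem_lineWith, dotProduct_comm, dot_cross_self]

end Coordinates

/-! ### Collineations -/

section Collineations

variable {K : Type*} [Field K]

theorem lineWith_smul (g : (Fin 3 → K) ≃ₗ[K] (Fin 3 → K)) {u : Fin 3 → K} (hu : u ≠ 0) :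
    ∃ w, w ≠ 0 ∧ g • lineWith u = lineWith w := by
  let f : Module.Dual K (Fin 3 → K) := (dotProductEquiv K (Fin 3) u) ∘ₗ g.symm.toLinearMap
  have hf (v) : (dotProductEquiv K (Fin 3)).symm f ⬝ᵥ v = u ⬝ᵥ g.symm v := by
    rw [← dotProductEquiv_apply_apply, LinearEquiv.apply_symm_apply]
    simp [f]
  refine ⟨(dotProductEquiv K (Fin 3)).symm f, fun h => hu ?_, ?_⟩
  · refine dotProduct_eq_zero u fun v => ?_
    have := hf (g v)
    rwa [h, zero_dotProduct, LinearEquiv.symm_apply_apply, eq_comm] at this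
  · ext P
    rw [Set.mem_smul_set_iff_inv_smul_mem]
    induction P using Projectivization.ind with
    | h v hv =>
      rw [Projectivization.smul_mk, mk_mem_lineWith, mk_mem_lineWith, hf]
      rfl

theorem IsLine.smul {l : Set (PGPoint K)} (hl : IsLine l)
    (g : (Fin 3 → K) ≃ₗ[K] (Fin 3 → K)) : IsLine (g • l) := by
  obtain ⟨u, hu, rfl⟩ := hl
  exact lineWith_smul g hu

@[simp] theorem isLine_smul (g : (Fin 3 → K) ≃ₗ[K] (Fin 3 → K)) {l : Set (PGPoint K)} :
    IsLine (g • l) ↔ IsLine l :=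
  ⟨fun h => by simpa using h.smul g⁻¹, fun h => h.smul g⟩

theorem AreCollinear.smul {A B C : PGPoint K} (h : AreCollinear A B C)
    (g : (Fin 3 → K) ≃ₗ[K] (Fin 3 → K)) : AreCollinear (g • A) (g • B) (g • C) := by
  obtain ⟨l, hl, hA, hB, hC⟩ := h
  exact ⟨g • l, hl.smul g, Set.smul_mem_smul_set hA, Set.smul_mem_smul_set hB,
    Set.smul_mem_smul_set hC⟩

@[simp] theorem areCollinear_smul (g : (Fin 3 → K) ≃ₗ[K] (Fin 3 → K)) {A B C : PGPoint K} :
    AreCollinear (g • A) (g • B) (g • C) ↔ AreCollinear A B C :=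
  ⟨fun h => by simpa using h.smul g⁻¹, fun h => h.smul g⟩

theorem IsLineOf.smul {B l : Set (PGPoint K)} (h : IsLineOf B l)
    (g : (Fin 3 → K) ≃ₗ[K] (Fin 3 → K)) : IsLineOf (g • B) (g • l) := by
  obtain ⟨hl, X, hX, Y, hY, hXY⟩ := h
  refine ⟨hl.smul g, g • X, ?_, g • Y, ?_, by simpa using hXY⟩
  · exact ⟨Set.smul_mem_smul_set hX.1, Set.smul_mem_smul_set hX.2⟩
  · exact ⟨Set.smul_mem_smul_set hY.1, Set.smul_mem_smul_set hY.2⟩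

theorem IsLineOf.exists_eq_smul {B l : Set (PGPoint K)} {g : (Fin 3 → K) ≃ₗ[K] (Fin 3 → K)}
    (h : IsLineOf (g • B) l) : ∃ m, IsLineOf B m ∧ l = g • m :=
  ⟨g⁻¹ • l, by simpa using h.smul g⁻¹, by simp⟩

theorem IsSubplaneOfOrder.smul {q : ℕ} {B : Set (PGPoint K)} (h : IsSubplaneOfOrder q B)
    (g : (Fin 3 → K) ≃ₗ[K] (Fin 3 → K)) : IsSubplaneOfOrder q (g • B) where
  meet := by
    intro l m hl hm hlm
    obtain ⟨l, hl', rfl⟩ := hl.exists_eq_smul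
    obtain ⟨m, hm', rfl⟩ := hm.exists_eq_smul
    obtain ⟨X, hX, hXl, hXm⟩ := h.meet l m hl' hm' (by rintro rfl; exact hlm rfl)
    exact ⟨g • X, Set.smul_mem_smul_set hX, Set.smul_mem_smul_set hXl, Set.smul_mem_smul_set hXm⟩
  quadrangle := by
    obtain ⟨P, hP, Q, hQ, R, hR, S, hS, h⟩ := h.quadrangle
    exact ⟨g • P, Set.smul_mem_smul_set hP, g • Q, Set.smul_mem_smul_set hQ,
      g • R, Set.smul_mem_smul_set hR, g • S, Set.smul_mem_smul_set hS, by simpa using h⟩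
  order := by
    intro l hl
    obtain ⟨l, hl', rfl⟩ := hl.exists_eq_smul
    rw [← Set.smul_set_inter, Set.encard_smul_set, h.order l hl']

@[simp] theorem isSubplaneOfOrder_smul {q : ℕ} {B : Set (PGPoint K)}
    (g : (Fin 3 → K) ≃ₗ[K] (Fin 3 → K)) :
    IsSubplaneOfOrder q (g • B) ↔ IsSubplaneOfOrder q B :=
  ⟨fun h => by simpa using h.smul g⁻¹, fun h => h.smul g⟩

@[simp] theorem isBaerSecantTo_smul {q : ℕ} {l B : Set (PGPoint K)}
    (g : (Fin 3 → K) ≃ₗ[K] (Fin 3 → K)) :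
    IsBaerSecantTo q (g • l) (g • B) ↔ IsBaerSecantTo q l B := by
  simp [IsBaerSecantTo, IsBaerSubplane, ← Set.smul_set_inter, Set.encard_smul_set]

@[simp] theorem isCPlane_smul {q : ℕ} {l C B : Set (PGPoint K)}
    (g : (Fin 3 → K) ≃ₗ[K] (Fin 3 → K)) :
    IsCPlane q (g • l) (g • C) (g • B) ↔ IsCPlane q l C B := by
  simp [IsCPlane, ← Set.smul_set_inter, Set.encard_smul_set]

@[simp] theorem isTangentAt_smul {O l : Set (PGPoint K)} {P : PGPoint K}
    (g : (Fin 3 → K) ≃ₗ[K] (Fin 3 → K)) :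
    IsTangentAt (g • O) (g • l) (g • P) ↔ IsTangentAt O l P := by
  simp [IsTangentAt, ← Set.smul_set_inter, ← Set.smul_set_singleton]

theorem tangentsThrough_smul (O : Set (PGPoint K)) (X : PGPoint K)
    (g : (Fin 3 → K) ≃ₗ[K] (Fin 3 → K)) :
    tangentsThrough (g • O) (g • X) = g • tangentsThrough O X := by
  ext l
  rw [Set.mem_smul_set_iff_inv_smul_mem]
  constructor
  · rintro ⟨⟨P, hP⟩, hX⟩
    refine ⟨⟨g⁻¹ • P, ?_⟩, ?_⟩
    · rw [← isTangentAt_smul g]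
      simpa using hP
    · rwa [Set.mem_inv_smul_set_iff]
  · rintro ⟨⟨P, hP⟩, hX⟩
    refine ⟨⟨g • P, ?_⟩, ?_⟩
    · rw [← isTangentAt_smul g⁻¹]
      simpa using hP
    · rwa [Set.mem_inv_smul_set_iff] at hX

@[simp] theorem isInteriorPoint_smul {O : Set (PGPoint K)} {X : PGPoint K}
    (g : (Fin 3 → K) ≃ₗ[K] (Fin 3 → K)) :
    IsInteriorPoint (g • O) (g • X) ↔ IsInteriorPoint O X := by
  simp [IsInteriorPoint, tangentsThrough_smul]

@[simp] theorem isExteriorPoint_smul {O : Set (PGPoint K)} {X : PGPoint K}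
    (g : (Fin 3 → K) ≃ₗ[K] (Fin 3 → K)) :
    IsExteriorPoint (g • O) (g • X) ↔ IsExteriorPoint O X := by
  simp [IsExteriorPoint, tangentsThrough_smul, Set.encard_smul_set]

end Collineations

/-! ### Normal form of a conic with a tangent line -/

section NormalForm

variable {K : Type*} [Field K]

variable (K) in
/-- The conic `x² = yz`. Its affine points are the points `(t, t²)`, and the line at infinity is
tangent to it at the vertical point. -/
def parabola : Set (PGPoint K) := {P | P.rep 0 ^ 2 = P.rep 1 * P.rep 2}

theorem mk_mem_parabola {v : Fin 3 → K} (hv : v ≠ 0) :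
    Projectivization.mk K v hv ∈ parabola K ↔ v 0 ^ 2 = v 1 * v 2 := by
  obtain ⟨a, ha⟩ := Projectivization.exists_smul_eq_mk_rep K v hv
  have ha0 : (a : K) ^ 2 ≠ 0 := pow_ne_zero 2 a.ne_zero
  simp only [parabola, Set.mem_ofPred_eq, ← ha, Units.smul_def, Pi.smul_apply, smul_eq_mul]
  rw [← mul_right_inj' ha0 (b := v 0 ^ 2)]
  ring_nf

@[simp] theorem affinePoint_mem_parabola {x y : K} :
    affinePoint x y ∈ parabola K ↔ y = x ^ 2 := by
  simp [affinePoint, mk_mem_parabola, eq_comm]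

@[simp] theorem slopePoint_notMem_parabola (m : K) : slopePoint m ∉ parabola K := by
  simp [slopePoint, mk_mem_parabola]

@[simp] theorem verticalPoint_mem_parabola : verticalPoint K ∈ parabola K := by
  simp [verticalPoint, mk_mem_parabola]

theorem mem_parabola_iff {P : PGPoint K} :
    P ∈ parabola K ↔ P = verticalPoint K ∨ ∃ t, P = affinePoint t (t ^ 2) := by
  rcases exists_coordinates P with ⟨x, y, rfl⟩ | ⟨m, rfl⟩ | rfl
  · simp
  · simp [(affinePoint_ne_slopePoint _ _ _).symm]
  · simp

variable (K) in
/-- The affine part of the parabola. -/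
def affineParabola : Set (PGPoint K) := parabola K \ {verticalPoint K}

theorem mem_affineParabola_iff {P : PGPoint K} :
    P ∈ affineParabola K ↔ ∃ t, P = affinePoint t (t ^ 2) := by
  rw [affineParabola, Set.mem_sdiff, mem_parabola_iff]
  constructor
  · rintro ⟨rfl | h, h'⟩
    · simp at h'
    · exact h
  · rintro ⟨t, rfl⟩
    simp

@[simp] theorem affinePoint_mem_affineParabola {x y : K} :
    affinePoint x y ∈ affineParabola K ↔ y = x ^ 2 := by
  simp [affineParabola]

/-- The polar form of the point of tangency vanishes on the tangent line. -/
theorem polar_eq_zero_of_isTangentAt {Q : QuadraticForm K (Fin 3 → K)} {u : Fin 3 → K}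
    {P : PGPoint K} (h : {P | Q P.rep = 0} ∩ lineWith u = {P}) {w : Fin 3 → K}
    (hw : u ⬝ᵥ w = 0) : QuadraticMap.polar Q P.rep w = 0 := by
  have hP : P ∈ {P | Q P.rep = 0} ∩ lineWith u := h ▸ rfl
  have hQP : Q P.rep = 0 := hP.1
  have huP : u ⬝ᵥ P.rep = 0 := hP.2
  by_contra hb
  set b := QuadraticMap.polar Q P.rep w with hbdef
  have hpar : ∀ c : K, w ≠ c • P.rep := by
    rintro c rfl
    rw [hbdef, QuadraticMap.polar_smul_right, QuadraticMap.polar_self, hQP] at hb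
    simp at hb
  -- the second intersection of the conic with the line joining `P` to `w`
  set v := w - (Q w / b) • P.rep with hv
  have hv0 : v ≠ 0 := fun h0 => hpar _ (sub_eq_zero.1 h0)
  have hQv : Q v = 0 := by
    have h1 : QuadraticMap.polar Q w (-(Q w / b) • P.rep) =
        Q v - Q w - (Q w / b) ^ 2 * Q P.rep := by
      rw [QuadraticMap.polar, QuadraticMap.map_smul, hv, sub_eq_add_neg w, neg_smul, smul_eq_mul]
      ring
    rw [QuadraticMap.polar_smul_right, QuadraticMap.polar_comm, ← hbdef, hQP, smul_eq_mul] at h1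
    have h2 : -(Q w / b) * b = - Q w := by field_simp
    rw [h2] at h1
    linear_combination -h1
  have huv : u ⬝ᵥ v = 0 := by rw [hv, dotProduct_sub, dotProduct_smul, hw, huP]; simp
  obtain ⟨a, ha⟩ := Projectivization.exists_smul_eq_mk_rep K v hv0
  have hmem : Projectivization.mk K v hv0 ∈ {P | Q P.rep = 0} ∩ lineWith u := by
    refine ⟨?_, (mk_mem_lineWith hv0).2 huv⟩
    rw [Set.mem_ofPred_eq, ← ha, Units.smul_def, QuadraticMap.map_smul, hQv, smul_zero]
  rw [h, Set.mem_singleton_iff] at hmem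
  rw [hmem, Units.smul_def] at ha
  apply hpar ((a : K)⁻¹ + Q w / b)
  rw [add_smul, ← ha, smul_smul, inv_mul_cancel₀ a.ne_zero, one_smul, hv, ha]
  abel

/-- A conic with a tangent line is projectively equivalent to the parabola with the line at
infinity. -/
theorem exists_smul_parabola {conic linf : Set (PGPoint K)} {P : PGPoint K}
    (hconic : IsNondegenerateConic conic) (htangent : IsTangentAt conic linf P) :
    ∃ g : (Fin 3 → K) ≃ₗ[K] (Fin 3 → K),
      conic = g • parabola K ∧ linf = g • lineAtInfinity K ∧ P = g • verticalPoint K := by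
  obtain ⟨Q, hQ, rfl⟩ := hconic
  obtain ⟨⟨u, hu, rfl⟩, hP⟩ := htangent
  change _ ∩ lineWith u = _ at hP
  set p := P.rep with hp
  have hPmem : P ∈ {P | Q P.rep = 0} ∩ lineWith u := hP ▸ rfl
  have hQp : Q p = 0 := hPmem.1
  have hup : u ⬝ᵥ p = 0 := hPmem.2
  obtain ⟨e, he⟩ : ∃ e, u ⬝ᵥ e = 1 := by
    obtain ⟨v, hv⟩ : ∃ v, u ⬝ᵥ v ≠ 0 := by
      by_contra! h
      exact hu (dotProduct_eq_zero u h)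
    exact ⟨(u ⬝ᵥ v)⁻¹ • v, by rw [dotProduct_smul, smul_eq_mul, inv_mul_cancel₀ hv]⟩
  let B := Q.polarBilin
  have hBself (v) : B v v = 2 * Q v := by
    simp [B, QuadraticMap.polar_self, two_mul]
  have hBsymm (v w) : B v w = B w v := QuadraticMap.polar_comm _ _ _
  have hQadd (v w) : Q (v + w) = Q v + Q w + B v w := by
    simp [B, QuadraticMap.polar]
  have hQsmul (a : K) (v) : Q (a • v) = a ^ 2 * Q v := by
    rw [QuadraticMap.map_smul, smul_eq_mul, sq]
  have hBp (v) : B p v = u ⬝ᵥ v * B p e := by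
    have : B p (v - (u ⬝ᵥ v) • e) = 0 := by
      refine polar_eq_zero_of_isTangentAt hP ?_
      rw [dotProduct_sub, dotProduct_smul, he]
      simp
    rw [map_sub, map_smul, smul_eq_mul, sub_eq_zero] at this
    exact this
  have hc : B p e ≠ 0 := by
    intro h0
    refine P.rep_nonzero (hQ.1 p fun v => ?_)
    change B p v = 0
    rw [hBp, h0, mul_zero]
  obtain ⟨r₀, hpr₀⟩ : ∃ r₀, B p r₀ = 1 :=
    ⟨(B p e)⁻¹ • e, by rw [map_smul, smul_eq_mul, inv_mul_cancel₀ hc]⟩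
  -- a second point of the conic
  set r := r₀ + (-Q r₀) • p with hr
  have hpp : B p p = 0 := by rw [hBself, hQp, mul_zero]
  have hpr : B p r = 1 := by rw [hr, map_add, map_smul, hpr₀, hpp]; simp
  have hQr : Q r = 0 := by
    rw [hr, hQadd, hQsmul, hQp, map_smul, hBsymm, hpr₀]; simp
  -- the pole of the line joining the two points
  obtain ⟨m, hm, hm0⟩ : ∃ m ∈ LinearMap.ker ((B p).prod (B r)), m ≠ 0 := by
    refine Submodule.exists_mem_ne_zero_of_ne_bot (LinearMap.ker_ne_bot_of_finrank_lt ?_)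
    simp
  have hpm : B p m = 0 := congrArg Prod.fst hm
  have hrm : B r m = 0 := congrArg Prod.snd hm
  have hrr : B r r = 0 := by rw [hBself, hQr, mul_zero]
  let T : (Fin 3 → K) →ₗ[K] (Fin 3 → K) :=
    (LinearMap.proj 0).smulRight m + (LinearMap.proj 1).smulRight (-Q m • p) +
      (LinearMap.proj 2).smulRight r
  have hT (v) : T v = v 0 • m + v 1 • (-Q m • p) + v 2 • r := rfl
  have hpT (v) : B p (T v) = v 2 := by
    simp only [hT, map_add, map_smul, hpm, hpp, hpr]; simp
  have hrT (v) : B r (T v) = - Q m * v 1 := by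
    simp only [hT, map_add, map_smul, hrm, hrr, hBsymm r p, hpr]; simp [mul_comm]
  have hQm : Q m ≠ 0 := by
    intro h0
    refine hm0 (hQ.1 m fun v => ?_)
    change B m v = 0
    -- otherwise `p`, `m`, `r` would be a basis orthogonal to `m`
    let S : (Fin 3 → K) →ₗ[K] (Fin 3 → K) :=
      (LinearMap.proj 0).smulRight m + (LinearMap.proj 1).smulRight p +
        (LinearMap.proj 2).smulRight r
    have hS (v) : S v = v 0 • m + v 1 • p + v 2 • r := rfl
    have hinj : Function.Injective S := by
      rw [injective_iff_map_eq_zero]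
      intro w hw
      have w2 : w 2 = 0 := by
        have : B p (S w) = w 2 := by
          simp only [hS, map_add, map_smul, hpm, hpp, hpr]; simp
        rw [← this, hw, map_zero]
      have w1 : w 1 = 0 := by
        have : B r (S w) = w 1 := by
          simp only [hS, map_add, map_smul, hrm, hrr, hBsymm r p, hpr]; simp
        rw [← this, hw, map_zero]
      have w0 : w 0 = 0 := by
        rw [hS, w1, w2] at hw
        simpa [hm0] using hw
      ext i; fin_cases i <;> assumption
    obtain ⟨w, rfl⟩ := LinearMap.surjective_of_injective hinj v
    have hmm : B m m = 0 := by rw [hBself, h0, mul_zero]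
    simp only [hS, map_add, map_smul, hBsymm m p, hBsymm m r, hpm, hrm, hmm]
    simp
  have hinj : Function.Injective T := by
    rw [injective_iff_map_eq_zero]
    intro w hw
    have w2 : w 2 = 0 := by rw [← hpT w, hw, map_zero]
    have w1 : w 1 = 0 := by
      have := hrT w
      rw [hw, map_zero] at this
      simpa [hQm] using this.symm
    have w0 : w 0 = 0 := by
      rw [hT, w1, w2] at hw
      simpa [hm0] using hw
    ext i; fin_cases i <;> assumption
  have hQT (v) : Q (T v) = Q m * (v 0 ^ 2 - v 1 * v 2) := by
    have hmp : B m p = 0 := by rw [hBsymm, hpm]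
    have hmr : B m r = 0 := by rw [hBsymm, hrm]
    rw [hT, hQadd, hQadd, hQsmul, hQsmul, hQsmul, hQsmul, hQp, hQr]
    simp only [map_add, map_smul, LinearMap.add_apply, LinearMap.smul_apply, hmp, hmr, hpr,
      smul_eq_mul]
    ring
  let g := LinearEquiv.ofInjectiveEndo T hinj
  have hg (v) : g • v = T v := rfl
  have huT (v) : u ⬝ᵥ T v = 0 ↔ v 2 = 0 := by
    rw [← hpT v, hBp]
    simp [hc]
  refine ⟨g, ?_, ?_, ?_⟩
  · ext X
    obtain ⟨X, rfl⟩ : ∃ Y, X = g • Y := ⟨g⁻¹ • X, by simp⟩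
    rw [Set.smul_mem_smul_set_iff]
    induction X using Projectivization.ind with
    | h v hv =>
      rw [mk_mem_parabola, Projectivization.smul_mk, Set.mem_ofPred_eq]
      obtain ⟨a, ha⟩ := Projectivization.exists_smul_eq_mk_rep K (g • v)
        ((smul_ne_zero_iff_ne g).mpr hv)
      rw [← ha, Units.smul_def, hQsmul, hg, hQT]
      simp [hQm, sub_eq_zero]
  · ext X
    obtain ⟨X, rfl⟩ : ∃ Y, X = g • Y := ⟨g⁻¹ • X, by simp⟩
    rw [Set.smul_mem_smul_set_iff]
    change _ ∈ lineWith u ↔ _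
    induction X using Projectivization.ind with
    | h v hv =>
      rw [lineAtInfinity, mk_mem_lineWith, Projectivization.smul_mk, mk_mem_lineWith, hg, huT]
      simp [dotProduct, Fin.sum_univ_three]
  · rw [verticalPoint, Projectivization.smul_mk, ← P.mk_rep, Projectivization.mk_eq_mk_iff']
    refine ⟨(-Q m)⁻¹, ?_⟩
    rw [hg, hT]
    simp [hQm, ← hp, smul_smul]

end NormalForm

/-! ### Tangent lines of the parabola -/

section Tangents

variable {K : Type*} [Field K]

/-- The tangent line of the parabola at the point `(t, t²)`. -/
def tangentLine (t : K) : Set (PGPoint K) := lineWith ![-(2 * t), 1, t ^ 2]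

theorem affinePoint_mem_tangentLine {t x y : K} :
    affinePoint x y ∈ tangentLine t ↔ (t - x) ^ 2 = x ^ 2 - y := by
  rw [tangentLine, affinePoint_mem_lineWith]
  simp only [Matrix.cons_val]
  constructor <;> intro h <;> linear_combination h

theorem isTangentAt_tangentLine (t : K) :
    IsTangentAt (parabola K) (tangentLine t) (affinePoint t (t ^ 2)) := by
  refine ⟨isLine_lineWith fun h => by simpa using congrFun h 1, ?_⟩
  ext P
  rw [Set.mem_inter_iff, Set.mem_singleton_iff, mem_parabola_iff]
  constructor
  · rintro ⟨rfl | ⟨s, rfl⟩, h⟩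
    · simp [tangentLine, verticalPoint_mem_lineWith] at h
    · rw [affinePoint_mem_tangentLine, sub_self, sq_eq_zero_iff, sub_eq_zero] at h
      rw [h]
  · rintro rfl
    exact ⟨.inr ⟨t, rfl⟩, by simp [affinePoint_mem_tangentLine]⟩

theorem tangentLine_injective : Function.Injective (tangentLine (K := K)) := by
  intro s t h
  have h1 := (isTangentAt_tangentLine s).2
  rw [h, (isTangentAt_tangentLine t).2, Set.singleton_eq_singleton_iff, affinePoint_inj] at h1
  exact h1.1.symm

theorem exists_eq_tangentLine {l : Set (PGPoint K)} {P : PGPoint K}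
    (h : IsTangentAt (parabola K) l P) {x y : K} (hxy : affinePoint x y ∈ l) :
    ∃ t, l = tangentLine t := by
  obtain ⟨⟨u, hu, rfl⟩, h⟩ := h
  change affinePoint x y ∈ lineWith u at hxy
  change ∃ t, lineWith u = _
  change _ ∩ lineWith u = _ at h
  have huniq {X : PGPoint K} (hX : X ∈ parabola K) (hXu : X ∈ lineWith u) : X = P := by
    have : X ∈ parabola K ∩ lineWith u := ⟨hX, hXu⟩
    rwa [h] at this
  have hP : P ∈ parabola K ∩ lineWith u := h ▸ rfl
  rw [affinePoint_mem_lineWith] at hxy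
  by_cases h1 : u 1 = 0
  · -- vertical lines meet the parabola in two points
    by_cases h0 : u 0 = 0
    · refine absurd ?_ hu
      ext i; fin_cases i
      · exact h0
      · exact h1
      · simpa [h0, h1] using hxy
    · have e1 := huniq verticalPoint_mem_parabola (verticalPoint_mem_lineWith.2 h1)
      have e2 := huniq (X := affinePoint (-u 2 / u 0) ((-u 2 / u 0) ^ 2)) (by simp)
        (by rw [affinePoint_mem_lineWith, h1]; field_simp; ring)
      exact absurd (e2.trans e1.symm) (affinePoint_ne_verticalPoint _ _)
  · rcases mem_parabola_iff.1 hP.1 with rfl | ⟨t, rfl⟩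
    · exact absurd (verticalPoint_mem_lineWith.1 hP.2) h1
    · have ht := affinePoint_mem_lineWith.1 hP.2
      -- the second root of the quadratic equation has to agree with the first
      have e := huniq (X := affinePoint (-u 0 / u 1 - t) ((-u 0 / u 1 - t) ^ 2)) (by simp)
        (by rw [affinePoint_mem_lineWith]; field_simp; linear_combination u 1 * ht)
      have e0 : u 0 = -(2 * t) * u 1 := by
        have := (affinePoint_inj.1 e).1
        field_simp at this
        linear_combination -this
      refine ⟨t, ?_⟩
      have : u = u 1 • ![-(2 * t), 1, t ^ 2] := by
        ext i; fin_cases i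
        · simp [e0, mul_comm]
        · simp
        · simp only [Fin.reduceFinMk, Pi.smul_apply, Matrix.cons_val, smul_eq_mul]
          linear_combination ht - t * e0
      rw [this, tangentLine]
      ext X
      rw [lineWith, lineWith, Set.mem_ofPred_eq, Set.mem_ofPred_eq, smul_dotProduct, smul_eq_zero,
        or_iff_right h1]

theorem tangentsThrough_parabola (x y : K) :
    tangentsThrough (parabola K) (affinePoint x y) =
      tangentLine '' {t | (t - x) ^ 2 = x ^ 2 - y} := by
  ext l
  constructor
  · rintro ⟨⟨P, hP⟩, hl⟩
    obtain ⟨t, rfl⟩ := exists_eq_tangentLine hP hl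
    exact ⟨t, affinePoint_mem_tangentLine.1 hl, rfl⟩
  · rintro ⟨t, ht, rfl⟩
    exact ⟨⟨_, isTangentAt_tangentLine t⟩, affinePoint_mem_tangentLine.2 ht⟩

theorem isInteriorPoint_parabola_iff {x y : K} :
    IsInteriorPoint (parabola K) (affinePoint x y) ↔ ¬ IsSquare (x ^ 2 - y) := by
  rw [IsInteriorPoint, tangentsThrough_parabola, affinePoint_mem_parabola, Set.image_eq_empty,
    Set.eq_empty_iff_forall_notMem]
  constructor
  · rintro ⟨-, h⟩ ⟨r, hr⟩
    exact h (r + x) (by rw [Set.mem_ofPred_eq, hr]; ring)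
  · intro h
    refine ⟨?_, fun t ht => h ⟨t - x, by rw [← ht, sq]⟩⟩
    rintro rfl
    simp at h

theorem isExteriorPoint_parabola_iff (h2 : (2 : K) ≠ 0) {x y : K} :
    IsExteriorPoint (parabola K) (affinePoint x y) ↔ ∃ r, r ≠ 0 ∧ x ^ 2 - y = r ^ 2 := by
  rw [IsExteriorPoint, tangentsThrough_parabola, affinePoint_mem_parabola,
    tangentLine_injective.encard_image]
  constructor
  · rintro ⟨hy, h⟩
    obtain ⟨t, ht⟩ : {t | (t - x) ^ 2 = x ^ 2 - y}.Nonempty := by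
      rw [← Set.encard_ne_zero, h]
      simp
    refine ⟨t - x, fun h0 => hy ?_, ht.symm⟩
    rw [Set.mem_ofPred_eq, h0] at ht
    linear_combination ht
  · rintro ⟨r, hr, h⟩
    have hset : {t | (t - x) ^ 2 = x ^ 2 - y} = {x + r, x - r} := by
      ext t
      rw [Set.mem_ofPred_eq, h, sq_eq_sq_iff_eq_or_eq_neg, Set.mem_insert_iff,
        Set.mem_singleton_iff, sub_eq_iff_eq_add', sub_eq_iff_eq_add', sub_eq_add_neg]
    refine ⟨fun hy => hr ?_, ?_⟩
    · rw [hy, sub_self] at h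
      exact pow_eq_zero_iff two_ne_zero |>.1 h.symm
    · rw [hset, Set.encard_pair]
      intro h'
      have : 2 * r = 0 := by linear_combination h'
      simp [h2, hr] at this

/-- A line contains at most two points of the affine part of the parabola. -/
theorem not_areCollinear_of_mem_affineParabola {X Y Z : PGPoint K} (hX : X ∈ affineParabola K)
    (hY : Y ∈ affineParabola K) (hZ : Z ∈ affineParabola K) (hXY : X ≠ Y) (hXZ : X ≠ Z)
    (hYZ : Y ≠ Z) : ¬ AreCollinear X Y Z := by
  rintro ⟨_, ⟨u, hu, rfl⟩, h1, h2, h3⟩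
  obtain ⟨r, rfl⟩ := mem_affineParabola_iff.1 hX
  obtain ⟨s, rfl⟩ := mem_affineParabola_iff.1 hY
  obtain ⟨t, rfl⟩ := mem_affineParabola_iff.1 hZ
  replace h1 := affinePoint_mem_lineWith.1 h1
  replace h2 := affinePoint_mem_lineWith.1 h2
  replace h3 := affinePoint_mem_lineWith.1 h3
  have hrs : r - s ≠ 0 := sub_ne_zero.2 fun h => hXY (by rw [h])
  have hrt : r - t ≠ 0 := sub_ne_zero.2 fun h => hXZ (by rw [h])
  have hst : s - t ≠ 0 := sub_ne_zero.2 fun h => hYZ (by rw [h])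
  have e1 : u 0 + u 1 * (r + s) = 0 := by
    apply mul_left_cancel₀ hrs
    linear_combination h1 - h2
  have e2 : u 0 + u 1 * (r + t) = 0 := by
    apply mul_left_cancel₀ hrt
    linear_combination h1 - h3
  have u1 : u 1 = 0 := by
    apply mul_left_cancel₀ hst
    linear_combination e1 - e2
  have u0 : u 0 = 0 := by simpa [u1] using e1
  have u2 : u 2 = 0 := by simpa [u1, u0] using h1
  exact hu (by ext i; fin_cases i <;> assumption)

end Tangents

/-! ### The subfield of order `q` -/

section Subfield

variable {K : Type*} [Field K]

theorem ringChar_ne_two_of_odd_card [Fintype K] (h : Odd (Fintype.card K)) : ringChar K ≠ 2 := by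
  rw [Ne, FiniteField.even_card_iff_char_two, ← Nat.even_iff]
  exact Nat.not_even_iff_odd.2 h

/-- A subfield of order `q` consists of the solutions of `x ^ q = x`. -/
theorem Subfield.mem_iff_pow_eq {q : ℕ} (hq : 1 < q) {F : Subfield K}
    (hF : (F : Set K).encard = q) (x : K) : x ∈ F ↔ x ^ q = x := by
  have hfin : (F : Set K).Finite := Set.finite_of_encard_eq_coe hF
  have : Finite F := hfin
  have hcard : Nat.card F = q := by
    have : (F : Set K).ncard = q := by rw [Set.ncard, hF]; rfl
    rwa [← Nat.card_coe_set_eq] at this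
  have : Fintype F := Fintype.ofFinite F
  have hpow : (F : Set K) ⊆ {x | x ^ q = x} := by
    intro x hx
    have h := FiniteField.pow_card (⟨x, hx⟩ : F)
    rw [← Nat.card_eq_fintype_card, hcard] at h
    exact congrArg Subtype.val h
  -- the polynomial `X ^ q - X` has at most `q` roots
  have hroots : {x : K | x ^ q = x} =
      ((Polynomial.X ^ q - Polynomial.X : Polynomial K).rootSet K) := by
    ext y
    rw [Polynomial.mem_rootSet_of_ne (FiniteField.X_pow_card_sub_X_ne_zero K hq)]
    simp [sub_eq_zero]
  have hle : {x : K | x ^ q = x}.encard ≤ q := by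
    classical
    rw [hroots, Polynomial.rootSet_def, Set.encard_coe_eq_coe_finsetCard]
    refine Nat.cast_le.2 ((Multiset.toFinset_card_le _).trans ?_)
    refine (Polynomial.card_roots' _).trans ?_
    rw [Polynomial.natDegree_map, FiniteField.X_pow_card_sub_X_natDegree_eq K hq]
  have hfin' : {x : K | x ^ q = x}.Finite := by
    rw [hroots]
    exact Polynomial.rootSet_finite _ _
  have heq := hfin'.eq_of_subset_of_encard_le' hpow (hle.trans hF.ge)
  exact Set.ext_iff.1 heq x

theorem exists_subfield_encard_eq [Fintype K] {q : ℕ} (hK : Fintype.card K = q ^ 2) :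
    ∃ F : Subfield K, (F : Set K).encard = q := by
  obtain ⟨p, hp⟩ := CharP.exists K
  have hprime : Fact p.Prime := ⟨CharP.char_is_prime K p⟩
  obtain ⟨n, -, hn⟩ := FiniteField.card K p
  obtain ⟨m, -, rfl⟩ := (Nat.dvd_prime_pow hprime.1).1
    (hn ▸ hK ▸ Dvd.intro_left _ (pow_succ q 1).symm)
  have hm : m ≠ 0 := by
    rintro rfl
    have := Fintype.one_lt_card (α := K)
    simp [hK] at this
  let _ : Algebra (ZMod p) K := ZMod.algebra K p
  have hdvd : Module.finrank (ZMod p) (GaloisField p m) ∣ Module.finrank (ZMod p) K := by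
    have h := FiniteField.pow_finrank_eq_card p (k := K)
    rw [hK, ← pow_mul] at h
    rw [GaloisField.finrank p hm, Nat.pow_right_injective hprime.1.two_le h]
    exact Dvd.intro _ rfl
  obtain ⟨f⟩ := FiniteField.nonempty_algHom_of_finrank_dvd hdvd
  refine ⟨f.toRingHom.fieldRange, ?_⟩
  rw [RingHom.coe_fieldRange, ← Set.image_univ, f.toRingHom.injective.encard_image,
    Set.encard_univ, ENat.card_eq_coe_natCard, GaloisField.card p m hm]

end Subfield

/-! ### The Baer subplane over a subfield -/

section Subplane

variable {K : Type*} [Field K]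

/-- The points of the plane that have coordinates in the subfield `F`. -/
def subplaneOver (F : Subfield K) : Set (PGPoint K) :=
  {P | ∃ (v : Fin 3 → K) (hv : v ≠ 0), (∀ i, v i ∈ F) ∧ P = Projectivization.mk K v hv}

variable {F : Subfield K}

@[simp] theorem affinePoint_mem_subplaneOver {x y : K} :
    affinePoint x y ∈ subplaneOver F ↔ x ∈ F ∧ y ∈ F := by
  constructor
  · rintro ⟨v, hv, hF, h⟩
    have h2 : v 2 ≠ 0 := by
      intro h2
      by_cases h0 : v 0 = 0
      · rw [mk_eq_verticalPoint hv h2 h0] at h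
        simp at h
      · rw [mk_eq_slopePoint hv h2 h0] at h
        simp at h
    rw [mk_eq_affinePoint hv h2, affinePoint_inj] at h
    rw [h.1, h.2]
    exact ⟨F.div_mem (hF 0) (hF 2), F.div_mem (hF 1) (hF 2)⟩
  · rintro ⟨hx, hy⟩
    refine ⟨_, _, fun i => ?_, rfl⟩
    fin_cases i
    · exact hx
    · exact hy
    · exact F.one_mem

@[simp] theorem slopePoint_mem_subplaneOver {m : K} : slopePoint m ∈ subplaneOver F ↔ m ∈ F := by
  constructor
  · rintro ⟨v, hv, hF, h⟩
    have h2 : v 2 = 0 := by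
      by_contra h2
      rw [mk_eq_affinePoint hv h2] at h
      exact affinePoint_ne_slopePoint _ _ _ h.symm
    have h0 : v 0 ≠ 0 := by
      intro h0
      rw [mk_eq_verticalPoint hv h2 h0] at h
      simp at h
    rw [mk_eq_slopePoint hv h2 h0, slopePoint_inj] at h
    rw [h]
    exact F.div_mem (hF 1) (hF 0)
  · intro hm
    refine ⟨_, _, fun i => ?_, rfl⟩
    fin_cases i
    · exact F.one_mem
    · exact hm
    · exact F.zero_mem

@[simp] theorem verticalPoint_mem_subplaneOver : verticalPoint K ∈ subplaneOver F := by
  refine ⟨_, _, fun i => ?_, rfl⟩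
  fin_cases i
  · exact F.zero_mem
  · exact F.one_mem
  · exact F.zero_mem

theorem cross_mem {v w : Fin 3 → K} (hv : ∀ i, v i ∈ F) (hw : ∀ i, w i ∈ F) (i : Fin 3) :
    crossProduct v w i ∈ F := by
  rw [cross_apply]
  fin_cases i
  · exact F.sub_mem (F.mul_mem (hv 1) (hw 2)) (F.mul_mem (hv 2) (hw 1))
  · exact F.sub_mem (F.mul_mem (hv 2) (hw 0)) (F.mul_mem (hv 0) (hw 2))
  · exact F.sub_mem (F.mul_mem (hv 0) (hw 1)) (F.mul_mem (hv 1) (hw 0))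

/-- The lines of the subplane over `F` have equations with coefficients in `F`. -/
theorem IsLineOf.exists_lineWith {l : Set (PGPoint K)} (h : IsLineOf (subplaneOver F) l) :
    ∃ u, u ≠ 0 ∧ (∀ i, u i ∈ F) ∧ l = lineWith u := by
  obtain ⟨hl, _, ⟨⟨v, hv, hvF, rfl⟩, hvl⟩, _, ⟨⟨w, hw, hwF, rfl⟩, hwl⟩, hne⟩ := h
  obtain ⟨h0, h1⟩ := hl.eq_lineWith_cross hv hw hne hvl hwl
  exact ⟨_, h0, cross_mem hvF hwF, h1⟩

theorem encard_subplaneOver_inter_lineWith {u : Fin 3 → K} (hu : u ≠ 0) (hF : ∀ i, u i ∈ F) :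
    (subplaneOver F ∩ lineWith u).encard = (F : Set K).encard + 1 := by
  -- each line consists of one special point and a family of points parametrized by `F`
  have key {f : K → PGPoint K} {P : PGPoint K} (hf : Function.Injective f) (hP : ∀ x, P ≠ f x)
      (h : subplaneOver F ∩ lineWith u = insert P (f '' F)) :
      (subplaneOver F ∩ lineWith u).encard = (F : Set K).encard + 1 := by
    rw [h, Set.encard_insert_of_notMem, hf.encard_image]
    rintro ⟨x, -, hx⟩
    exact hP x hx.symm
  have hF0 := hF 0
  have hF1 := hF 1
  have hF2 := hF 2
  by_cases h1 : u 1 = 0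
  · by_cases h0 : u 0 = 0
    · have h2 : u 2 ≠ 0 := fun h2 => hu (by ext i; fin_cases i <;> assumption)
      refine key (f := slopePoint) (P := verticalPoint K) (fun a b h => slopePoint_inj.1 h)
        (fun x h => slopePoint_ne_verticalPoint _ h.symm) ?_
      ext P
      rcases exists_coordinates P with ⟨x, y, rfl⟩ | ⟨m, rfl⟩ | rfl
      · simp [affinePoint_mem_lineWith, h0, h1, h2, (affinePoint_ne_slopePoint _ _ _).symm]
      · simp [slopePoint_mem_lineWith, h0, h1]
      · simp [verticalPoint_mem_lineWith, h1]
    · refine key (f := fun y => affinePoint (-u 2 / u 0) y) (P := verticalPoint K)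
        (fun a b h => (affinePoint_inj.1 h).2)
        (fun x h => affinePoint_ne_verticalPoint _ _ h.symm) ?_
      ext P
      rcases exists_coordinates P with ⟨x, y, rfl⟩ | ⟨m, rfl⟩ | rfl
      · have : u 0 * x + u 2 = 0 ↔ -u 2 / u 0 = x := by
          rw [div_eq_iff h0]
          constructor <;> intro h <;> linear_combination -h
        simp only [Set.mem_inter_iff, affinePoint_mem_subplaneOver, affinePoint_mem_lineWith, h1,
          zero_mul, add_zero, this, Set.mem_insert_iff, affinePoint_ne_verticalPoint, false_or,
          Set.mem_image, affinePoint_inj, SetLike.mem_coe]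
        constructor
        · rintro ⟨⟨hx, hy⟩, rfl⟩
          exact ⟨y, hy, rfl, rfl⟩
        · rintro ⟨y, hy, rfl, rfl⟩
          exact ⟨⟨F.div_mem (F.neg_mem hF2) hF0, hy⟩, rfl⟩
      · simp [slopePoint_mem_lineWith, h0, h1]
      · simp [verticalPoint_mem_lineWith, h1]
  · refine key (f := fun x => affinePoint x (-(u 0 * x + u 2) / u 1)) (P := slopePoint (-u 0 / u 1))
      (fun a b h => (affinePoint_inj.1 h).1) (fun x h => affinePoint_ne_slopePoint _ _ _ h.symm) ?_
    ext P
    rcases exists_coordinates P with ⟨x, y, rfl⟩ | ⟨m, rfl⟩ | rfl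
    · have : u 0 * x + u 1 * y + u 2 = 0 ↔ -(u 0 * x + u 2) / u 1 = y := by
        rw [div_eq_iff h1]
        constructor <;> intro h <;> linear_combination -h
      simp only [Set.mem_inter_iff, affinePoint_mem_subplaneOver, affinePoint_mem_lineWith, this,
        Set.mem_insert_iff, affinePoint_ne_slopePoint, false_or,
        Set.mem_image, affinePoint_inj, SetLike.mem_coe]
      constructor
      · rintro ⟨⟨hx, hy⟩, rfl⟩
        exact ⟨x, hx, rfl, rfl⟩
      · rintro ⟨x, hx, rfl, rfl⟩
        exact ⟨⟨hx, F.div_mem (F.neg_mem (F.add_mem (F.mul_mem hF0 hx) hF2)) hF1⟩, rfl⟩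
    · have : u 0 + u 1 * m = 0 ↔ m = -u 0 / u 1 := by
        rw [eq_div_iff h1]
        constructor <;> intro h <;> linear_combination h
      simp only [Set.mem_inter_iff, slopePoint_mem_subplaneOver, slopePoint_mem_lineWith, this,
        Set.mem_insert_iff, slopePoint_inj, Set.mem_image, affinePoint_ne_slopePoint, and_false,
        exists_false, or_false, and_iff_right_iff_imp]
      rintro rfl
      exact F.div_mem (F.neg_mem hF0) hF1
    · simp [verticalPoint_mem_lineWith, h1, (slopePoint_ne_verticalPoint _).symm]

theorem isSubplaneOfOrder_subplaneOver {q : ℕ} (hF : (F : Set K).encard = q) :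
    IsSubplaneOfOrder q (subplaneOver F) where
  meet := by
    intro l m hl hm hlm
    obtain ⟨u, hu, huF, rfl⟩ := hl.exists_lineWith
    obtain ⟨w, hw, hwF, rfl⟩ := hm.exists_lineWith
    have h0 : crossProduct u w ≠ 0 := fun h => hlm (lineWith_eq_of_cross_eq_zero hu hw h)
    refine ⟨Projectivization.mk K _ h0, ⟨_, h0, cross_mem huF hwF, rfl⟩, ?_, ?_⟩
    · rw [mk_mem_lineWith, dot_self_cross]
    · rw [mk_mem_lineWith, dot_cross_self]
  quadrangle := by
    refine ⟨verticalPoint K, by simp, slopePoint 0, by simp, affinePoint 0 0, by simp,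
      affinePoint 1 1, by simp, ?_, ?_, ?_, ?_⟩ <;>
    · rintro ⟨_, ⟨u, hu, rfl⟩, h1, h2, h3⟩
      change _ ∈ lineWith u at h1 h2 h3
      refine hu ?_
      simp only [verticalPoint_mem_lineWith, slopePoint_mem_lineWith,
        affinePoint_mem_lineWith] at h1 h2 h3
      ext i; fin_cases i <;> simp_all
  order := by
    intro l hl
    obtain ⟨u, hu, huF, rfl⟩ := hl.exists_lineWith
    rw [encard_subplaneOver_inter_lineWith hu huF, hF]

theorem isBaerSecantTo_subplaneOver {q : ℕ} (hK : Nat.card K = q ^ 2)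
    (hF : (F : Set K).encard = q) : IsBaerSecantTo q (lineAtInfinity K) (subplaneOver F) := by
  refine ⟨⟨hK, isSubplaneOfOrder_subplaneOver hF⟩, ?_⟩
  rw [lineAtInfinity, encard_subplaneOver_inter_lineWith, hF]
  · exact fun h => by simpa using congrFun h 2
  · intro i
    fin_cases i
    · exact F.zero_mem
    · exact F.zero_mem
    · exact F.one_mem

end Subplane

/-! ### Coordinatization of a subplane -/

section Coordinatization

variable {K : Type*} [Field K] {B : Set (PGPoint K)} {q : ℕ}

/-- The intersection of the line through `X`, `Y` with the line through `Z`, `W` belongs to a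
subplane containing these points. -/
theorem IsSubplaneOfOrder.inter_mem (hB : IsSubplaneOfOrder q B) {u w : Fin 3 → K} (hu : u ≠ 0)
    (hw : w ≠ 0) (X Y Z W : PGPoint K) {P : PGPoint K} (hX : X ∈ B) (hY : Y ∈ B) (hZ : Z ∈ B)
    (hW : W ∈ B) (hXY : X ≠ Y) (hZW : Z ≠ W) (hXu : X ∈ lineWith u) (hYu : Y ∈ lineWith u)
    (hZw : Z ∈ lineWith w) (hWw : W ∈ lineWith w) (hXw : X ∉ lineWith w) (hPu : P ∈ lineWith u)
    (hPw : P ∈ lineWith w) : P ∈ B := by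
  have hne : lineWith u ≠ lineWith w := fun h => hXw (h ▸ hXu)
  obtain ⟨R, hR, hRu, hRw⟩ := hB.meet (lineWith u) (lineWith w)
    ⟨isLine_lineWith hu, X, ⟨hX, hXu⟩, Y, ⟨hY, hYu⟩, hXY⟩
    ⟨isLine_lineWith hw, Z, ⟨hZ, hZw⟩, W, ⟨hW, hWw⟩, hZW⟩ hne
  by_contra hP
  have hRP : R ≠ P := by rintro rfl; exact hP hR
  exact hne ((isLine_lineWith hu).eq_of_mem (isLine_lineWith hw) hRP hRu hPu hRw hPw)

/-- A subplane having the line at infinity as one of its lines and containing the points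
`(0, 0)`, `(1, 0)` and `(0, 1)` is the subplane over a subfield. The subfield consists of the
abscissas of the points on the line `y = 0`, and its operations are constructed by intersecting
lines. -/
theorem IsSubplaneOfOrder.exists_eq_subplaneOver (hB : IsSubplaneOfOrder q B)
    {X Y : PGPoint K} (hX : X ∈ B) (hY : Y ∈ B) (hXY : X ≠ Y) (hXinf : X ∈ lineAtInfinity K)
    (hYinf : Y ∈ lineAtInfinity K) (h00 : affinePoint 0 0 ∈ B) (h10 : affinePoint 1 0 ∈ B)
    (h01 : affinePoint 0 1 ∈ B) :
    ∃ F : Subfield K, (F : Set K).encard = q ∧ B = subplaneOver F := by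
  have ne0 {a b c : K} (h : a ≠ 0 ∨ b ≠ 0 ∨ c ≠ 0) : ![a, b, c] ≠ 0 := by
    intro h0
    have e0 : a = 0 := congrFun h0 0
    have e1 : b = 0 := congrFun h0 1
    have e2 : c = 0 := congrFun h0 2
    simp_all
  have meet_inf {u : Fin 3 → K} (hu : u ≠ 0) (Z W : PGPoint K) {P : PGPoint K} (hZ : Z ∈ B)
      (hW : W ∈ B) (hZW : Z ≠ W) (hZu : Z ∈ lineWith u) (hWu : W ∈ lineWith u)
      (hZinf : Z ∉ lineAtInfinity K) (hPu : P ∈ lineWith u) (hP : P ∈ lineAtInfinity K) : P ∈ B :=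
    hB.inter_mem hu (ne0 (by simp)) Z W X Y hZ hW hX hY hZW hXY hZu hWu hXinf hYinf hZinf hPu hP
  have hs0 : slopePoint 0 ∈ B :=
    meet_inf (u := ![0, 1, 0]) (ne0 (by simp)) (affinePoint 0 0) (affinePoint 1 0) h00 h10
      (by simp) (by simp [affinePoint_mem_lineWith]) (by simp [affinePoint_mem_lineWith])
      (by simp) (by simp [slopePoint_mem_lineWith]) (by simp)
  have hv : verticalPoint K ∈ B :=
    meet_inf (u := ![1, 0, 0]) (ne0 (by simp)) (affinePoint 0 0) (affinePoint 0 1) h00 h01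
      (by simp) (by simp [affinePoint_mem_lineWith]) (by simp [affinePoint_mem_lineWith])
      (by simp) (by simp [verticalPoint_mem_lineWith]) (by simp)
  have hs1 : slopePoint (-1) ∈ B :=
    meet_inf (u := ![1, 1, -1]) (ne0 (by simp)) (affinePoint 1 0) (affinePoint 0 1) h10 h01
      (by simp) (by simp [affinePoint_mem_lineWith]) (by simp [affinePoint_mem_lineWith])
      (by simp) (by simp [slopePoint_mem_lineWith]) (by simp)
  -- projections onto the axes and the reflection `(x, 0) ↔ (0, x)`
  have proj_x {a b : K} (h : affinePoint a b ∈ B) : affinePoint a 0 ∈ B :=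
    hB.inter_mem (u := ![1, 0, -a]) (w := ![0, 1, 0]) (ne0 (by simp)) (ne0 (by simp))
      (verticalPoint K) (affinePoint a b) (affinePoint 0 0) (slopePoint 0) hv h h00 hs0
      (affinePoint_ne_verticalPoint _ _).symm (by simp)
      (by simp [verticalPoint_mem_lineWith]) (by simp [affinePoint_mem_lineWith])
      (by simp [affinePoint_mem_lineWith]) (by simp [slopePoint_mem_lineWith])
      (by simp [verticalPoint_mem_lineWith]) (by simp [affinePoint_mem_lineWith])
      (by simp [affinePoint_mem_lineWith])
  have proj_y {a b : K} (h : affinePoint a b ∈ B) : affinePoint 0 b ∈ B :=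
    hB.inter_mem (u := ![0, 1, -b]) (w := ![1, 0, 0]) (ne0 (by simp)) (ne0 (by simp))
      (slopePoint 0) (affinePoint a b) (affinePoint 0 0) (verticalPoint K) hs0 h h00 hv
      (affinePoint_ne_slopePoint _ _ _).symm (by simp)
      (by simp [slopePoint_mem_lineWith]) (by simp [affinePoint_mem_lineWith])
      (by simp [affinePoint_mem_lineWith]) (by simp [verticalPoint_mem_lineWith])
      (by simp [slopePoint_mem_lineWith]) (by simp [affinePoint_mem_lineWith])
      (by simp [affinePoint_mem_lineWith])
  have swap {a : K} (h : affinePoint a 0 ∈ B) : affinePoint 0 a ∈ B :=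
    hB.inter_mem (u := ![1, 1, -a]) (w := ![1, 0, 0]) (ne0 (by simp)) (ne0 (by simp))
      (slopePoint (-1)) (affinePoint a 0) (affinePoint 0 0) (verticalPoint K) hs1 h h00 hv
      (affinePoint_ne_slopePoint _ _ _).symm (by simp)
      (by simp [slopePoint_mem_lineWith]) (by simp [affinePoint_mem_lineWith])
      (by simp [affinePoint_mem_lineWith]) (by simp [verticalPoint_mem_lineWith])
      (by simp [slopePoint_mem_lineWith]) (by simp [affinePoint_mem_lineWith])
      (by simp [affinePoint_mem_lineWith])
  -- intersection of the line with slope `-1` through `(a, b)` with the axis `y = 0`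
  have slide {a b : K} (h : affinePoint a b ∈ B) : affinePoint (a + b) 0 ∈ B :=
    hB.inter_mem (u := ![1, 1, -(a + b)]) (w := ![0, 1, 0]) (ne0 (by simp)) (ne0 (by simp))
      (slopePoint (-1)) (affinePoint a b) (affinePoint 0 0) (slopePoint 0) hs1 h h00 hs0
      (affinePoint_ne_slopePoint _ _ _).symm (by simp)
      (by simp [slopePoint_mem_lineWith]) (by simp [affinePoint_mem_lineWith])
      (by simp [affinePoint_mem_lineWith]) (by simp [slopePoint_mem_lineWith])
      (by simp [slopePoint_mem_lineWith]) (by simp [affinePoint_mem_lineWith])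
      (by simp [affinePoint_mem_lineWith])
  have mem_iff {a b : K} :
      affinePoint a b ∈ B ↔ affinePoint a 0 ∈ B ∧ affinePoint b 0 ∈ B := by
    refine ⟨fun h => ⟨proj_x h, by simpa using slide (proj_y h)⟩, fun ⟨ha, hb⟩ => ?_⟩
    exact hB.inter_mem (u := ![1, 0, -a]) (w := ![0, 1, -b]) (ne0 (by simp)) (ne0 (by simp))
      (verticalPoint K) (affinePoint a 0) (slopePoint 0) (affinePoint 0 b) hv ha hs0 (swap hb)
      (affinePoint_ne_verticalPoint _ _).symm (affinePoint_ne_slopePoint _ _ _).symm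
      (by simp [verticalPoint_mem_lineWith]) (by simp [affinePoint_mem_lineWith])
      (by simp [slopePoint_mem_lineWith]) (by simp [affinePoint_mem_lineWith])
      (by simp [verticalPoint_mem_lineWith]) (by simp [affinePoint_mem_lineWith])
      (by simp [affinePoint_mem_lineWith])
  have slope_iff {m : K} : slopePoint m ∈ B ↔ affinePoint m 0 ∈ B := by
    constructor
    · intro hm
      refine ((mem_iff (a := 1) (b := m)).1 ?_).2
      exact hB.inter_mem (u := ![1, 0, -1]) (w := ![m, -1, 0]) (ne0 (by simp)) (ne0 (by simp))
        (verticalPoint K) (affinePoint 1 0) (slopePoint m) (affinePoint 0 0) hv h10 hm h00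
        (affinePoint_ne_verticalPoint _ _).symm (affinePoint_ne_slopePoint _ _ _).symm
        (by simp [verticalPoint_mem_lineWith]) (by simp [affinePoint_mem_lineWith])
        (by simp [slopePoint_mem_lineWith]) (by simp [affinePoint_mem_lineWith])
        (by simp [verticalPoint_mem_lineWith]) (by simp [affinePoint_mem_lineWith])
        (by simp [affinePoint_mem_lineWith])
    · intro hm
      exact meet_inf (u := ![m, -1, 0]) (ne0 (by simp)) (affinePoint 0 0) (affinePoint 1 m) h00
        (mem_iff.2 ⟨h10, hm⟩) (by simp) (by simp [affinePoint_mem_lineWith])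
        (by simp [affinePoint_mem_lineWith]) (by simp) (by simp [slopePoint_mem_lineWith]) (by simp)
  have mul {a b : K} (ha : affinePoint a 0 ∈ B) (hb : affinePoint b 0 ∈ B) :
      affinePoint (a * b) 0 ∈ B := by
    refine ((mem_iff (a := a) (b := a * b)).1 ?_).2
    exact hB.inter_mem (u := ![b, -1, 0]) (w := ![1, 0, -a]) (ne0 (by simp)) (ne0 (by simp))
      (slopePoint b) (affinePoint 0 0) (verticalPoint K) (affinePoint a 0) (slope_iff.2 hb) h00 hv
      ha (affinePoint_ne_slopePoint _ _ _).symm (affinePoint_ne_verticalPoint _ _).symm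
      (by simp [slopePoint_mem_lineWith]) (by simp [affinePoint_mem_lineWith])
      (by simp [verticalPoint_mem_lineWith]) (by simp [affinePoint_mem_lineWith])
      (by simp [slopePoint_mem_lineWith]) (by simp [affinePoint_mem_lineWith, mul_comm])
      (by simp [affinePoint_mem_lineWith])
  have inv {a : K} (ha : affinePoint a 0 ∈ B) : affinePoint a⁻¹ 0 ∈ B := by
    rcases eq_or_ne a 0 with rfl | ha0
    · simpa using h00
    refine ((mem_iff (a := 1) (b := a⁻¹)).1 ?_).2
    exact hB.inter_mem (u := ![1, -a, 0]) (w := ![1, 0, -1]) (ne0 (by simp)) (ne0 (by simp))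
      (affinePoint 0 0) (affinePoint a 1) (verticalPoint K) (affinePoint 1 0) h00
      (mem_iff.2 ⟨ha, h10⟩) hv h10 (by simp) (affinePoint_ne_verticalPoint _ _).symm
      (by simp [affinePoint_mem_lineWith]) (by simp [affinePoint_mem_lineWith])
      (by simp [verticalPoint_mem_lineWith]) (by simp [affinePoint_mem_lineWith])
      (by simp [affinePoint_mem_lineWith]) (by simp [affinePoint_mem_lineWith, ha0])
      (by simp [affinePoint_mem_lineWith])
  let F : Subfield K :=
    { carrier := {a | affinePoint a 0 ∈ B}
      mul_mem' := mul
      one_mem' := h10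
      add_mem' := fun ha hb => slide (mem_iff.2 ⟨ha, hb⟩)
      zero_mem' := h00
      neg_mem' := fun {a} ha => by simpa using mul (slope_iff.1 hs1) ha
      inv_mem' := fun a ha => inv ha }
  have hF (a) : a ∈ F ↔ affinePoint a 0 ∈ B := Iff.rfl
  refine ⟨F, ?_, ?_⟩
  · have h := hB.order (lineWith ![0, 1, 0])
      ⟨isLine_lineWith (ne0 (by simp)), _, ⟨h00, by simp [affinePoint_mem_lineWith]⟩, _,
        ⟨h10, by simp [affinePoint_mem_lineWith]⟩, by simp⟩
    have hset : B ∩ lineWith ![0, 1, 0] =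
        insert (slopePoint 0) ((affinePoint · 0) '' (F : Set K)) := by
      ext P
      rcases exists_coordinates P with ⟨x, y, rfl⟩ | ⟨m, rfl⟩ | rfl
      · simp only [Set.mem_inter_iff, affinePoint_mem_lineWith, Set.mem_insert_iff,
          affinePoint_ne_slopePoint, false_or, Set.mem_image, affinePoint_inj, SetLike.mem_coe, hF]
        constructor
        · rintro ⟨h1, h2⟩
          have : y = 0 := by simpa using h2
          subst this
          exact ⟨x, h1, rfl, rfl⟩
        · rintro ⟨x, h1, rfl, rfl⟩
          exact ⟨h1, by simp⟩
      · simp only [Set.mem_inter_iff, slopePoint_mem_lineWith, Set.mem_insert_iff, slopePoint_inj,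
          Set.mem_image, affinePoint_ne_slopePoint, and_false, exists_false, or_false]
        constructor
        · rintro ⟨-, h2⟩
          simpa using h2
        · rintro rfl
          exact ⟨hs0, by simp⟩
      · simp [verticalPoint_mem_lineWith, (slopePoint_ne_verticalPoint _).symm]
    rw [hset, Set.encard_insert_of_notMem (by simp),
      Function.Injective.encard_image fun a b h => (affinePoint_inj.1 h).1] at h
    exact ENat.add_left_injective_of_ne_top ENat.one_ne_top h
  · ext P
    rcases exists_coordinates P with ⟨x, y, rfl⟩ | ⟨m, rfl⟩ | rfl
    · rw [affinePoint_mem_subplaneOver, hF, hF, mem_iff]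
    · rw [slopePoint_mem_subplaneOver, hF, slope_iff]
    · simp [hv]

/-- A Baer subplane secant to the line at infinity and containing the points `(0, 0)`, `(1, 0)`
and `(0, 1)` is the subplane over the subfield of order `q`. -/
theorem IsBaerSecantTo.eq_subplaneOver (hq : 1 < q) {F : Subfield K} (hF : (F : Set K).encard = q)
    (hB : IsBaerSecantTo q (lineAtInfinity K) B) (h00 : affinePoint 0 0 ∈ B)
    (h10 : affinePoint 1 0 ∈ B) (h01 : affinePoint 0 1 ∈ B) : B = subplaneOver F := by
  have h1 : 1 < (B ∩ lineAtInfinity K).encard := by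
    rw [hB.2]
    exact_mod_cast hq.trans (Nat.lt_succ_self q)
  obtain ⟨X, hX, Y, hY, hXY⟩ := Set.one_lt_encard_iff_nontrivial.1 h1
  obtain ⟨F', hF', rfl⟩ := hB.1.2.exists_eq_subplaneOver hX.1 hY.1 hXY hX.2 hY.2 h00 h10 h01
  congr 1
  ext x
  rw [Subfield.mem_iff_pow_eq hq hF, Subfield.mem_iff_pow_eq hq hF']

end Coordinatization

/-! ### Affine maps -/

section AffineMaps

variable {K : Type*} [Field K]

/-- The affinity sending `(0, 0)`, `(1, 0)` and `(0, 1)` to `p`, `p + u` and `p + v`, as a linear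
automorphism of `K³`. -/
noncomputable def affinity (p₁ p₂ u₁ u₂ v₁ v₂ : K) (h : u₁ * v₂ - v₁ * u₂ ≠ 0) :
    (Fin 3 → K) ≃ₗ[K] (Fin 3 → K) :=
  LinearEquiv.ofInjectiveEndo (Matrix.mulVecLin !![u₁, v₁, p₁; u₂, v₂, p₂; 0, 0, 1]) <|
    Matrix.mulVec_injective_of_isUnit <| (Matrix.isUnit_iff_isUnit_det _).2 <| by
      simpa [Matrix.det_fin_three] using h

variable {p₁ p₂ u₁ u₂ v₁ v₂ : K} (h : u₁ * v₂ - v₁ * u₂ ≠ 0)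

theorem affinity_smul_apply (w : Fin 3 → K) : affinity p₁ p₂ u₁ u₂ v₁ v₂ h • w =
    ![u₁ * w 0 + v₁ * w 1 + p₁ * w 2, u₂ * w 0 + v₂ * w 1 + p₂ * w 2, w 2] := by
  change !![u₁, v₁, p₁; u₂, v₂, p₂; 0, 0, 1] *ᵥ w = _
  ext i; fin_cases i <;> simp [Matrix.mulVec, dotProduct, Fin.sum_univ_three]

theorem affinity_smul_affinePoint (x y : K) :
    affinity p₁ p₂ u₁ u₂ v₁ v₂ h • affinePoint x y =
      affinePoint (p₁ + x * u₁ + y * v₁) (p₂ + x * u₂ + y * v₂) := by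
  rw [affinePoint, affinePoint, Projectivization.smul_mk, Projectivization.mk_eq_mk_iff']
  refine ⟨1, ?_⟩
  rw [affinity_smul_apply, one_smul]
  ext i; fin_cases i <;> simp <;> ring

theorem affinity_smul_lineAtInfinity :
    affinity p₁ p₂ u₁ u₂ v₁ v₂ h • lineAtInfinity K = lineAtInfinity K := by
  ext X
  obtain ⟨X, rfl⟩ : ∃ Y, X = affinity p₁ p₂ u₁ u₂ v₁ v₂ h • Y :=
    ⟨(affinity p₁ p₂ u₁ u₂ v₁ v₂ h)⁻¹ • X, by simp⟩
  rw [Set.smul_mem_smul_set_iff]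
  induction X using Projectivization.ind with
  | h v hv =>
    rw [lineAtInfinity, Projectivization.smul_mk, mk_mem_lineWith, mk_mem_lineWith,
      affinity_smul_apply]
    simp [dotProduct, Fin.sum_univ_three]

theorem affinePoint_mem_affinity_smul {S : Set (PGPoint K)} {x y : K} :
    affinePoint x y ∈ affinity p₁ p₂ u₁ u₂ v₁ v₂ h • S ↔
      ∃ a b, affinePoint a b ∈ S ∧ x = p₁ + a * u₁ + b * v₁ ∧ y = p₂ + a * u₂ + b * v₂ := by
  constructor
  · rintro ⟨P, hP, hxy⟩
    replace hxy : affinity p₁ p₂ u₁ u₂ v₁ v₂ h • P = affinePoint x y := hxy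
    have hPinf : P ∉ lineAtInfinity K := by
      rw [← Set.smul_mem_smul_set_iff (a := affinity p₁ p₂ u₁ u₂ v₁ v₂ h),
        affinity_smul_lineAtInfinity]
      rw [hxy]
      exact affinePoint_notMem_lineAtInfinity x y
    obtain ⟨a, b, rfl⟩ := exists_affinePoint hPinf
    rw [affinity_smul_affinePoint, affinePoint_inj] at hxy
    exact ⟨a, b, hP, hxy.1.symm, hxy.2.symm⟩
  · rintro ⟨a, b, hS, rfl, rfl⟩
    exact ⟨_, hS, affinity_smul_affinePoint h a b⟩

theorem isBaerSecantTo_affinity_smul {q : ℕ} {B : Set (PGPoint K)} :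
    IsBaerSecantTo q (lineAtInfinity K) (affinity p₁ p₂ u₁ u₂ v₁ v₂ h • B) ↔
      IsBaerSecantTo q (lineAtInfinity K) B := by
  conv_lhs => rw [← affinity_smul_lineAtInfinity (p₁ := p₁) (p₂ := p₂) h]
  exact isBaerSecantTo_smul _

end AffineMaps

/-! ### Subplanes meeting the parabola in the parameters of an affine line over the subfield -/

section CPlanes

variable {K : Type*} [Field K]

/-- The affinity that preserves the parabola and maps its point with parameter `s` to the point
with parameter `t + s * d`. -/
noncomputable def parabolaAffinity (t : K) {d : K} (hd : d ≠ 0) :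
    (Fin 3 → K) ≃ₗ[K] (Fin 3 → K) :=
  affinity t (t ^ 2) d (2 * t * d) 0 (d ^ 2) (by simp [hd])

/-- The subplane whose points on the parabola are the points with parameters `t + s * d`, where
`s ∈ F`. -/
noncomputable def parabolaSubplane (F : Subfield K) (t : K) {d : K} (hd : d ≠ 0) :
    Set (PGPoint K) :=
  parabolaAffinity t hd • subplaneOver F

variable {F : Subfield K} {q : ℕ}

theorem affinePoint_mem_parabolaSubplane {t d x y : K} (hd : d ≠ 0) :
    affinePoint x y ∈ parabolaSubplane F t hd ↔ (x - t) / d ∈ F ∧ (y - x ^ 2) / d ^ 2 ∈ F := by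
  rw [parabolaSubplane, parabolaAffinity, affinePoint_mem_affinity_smul]
  constructor
  · rintro ⟨a, b, hab, rfl, rfl⟩
    rw [affinePoint_mem_subplaneOver] at hab
    have e1 : (t + a * d + b * 0 - t) / d = a := by field_simp; ring
    have e2 : (t ^ 2 + a * (2 * t * d) + b * d ^ 2 - (t + a * d + b * 0) ^ 2) / d ^ 2
        = b - a * a := by field_simp; ring
    rw [e1, e2]
    exact ⟨hab.1, F.sub_mem hab.2 (F.mul_mem hab.1 hab.1)⟩
  · rintro ⟨h1, h2⟩
    refine ⟨(x - t) / d, (y - x ^ 2) / d ^ 2 + (x - t) / d * ((x - t) / d),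
      affinePoint_mem_subplaneOver.2 ⟨h1, F.add_mem h2 (F.mul_mem h1 h1)⟩, ?_, ?_⟩
    · field_simp; ring
    · field_simp; ring

theorem isBaerSecantTo_parabolaSubplane (hK : Nat.card K = q ^ 2) (hF : (F : Set K).encard = q)
    (t : K) {d : K} (hd : d ≠ 0) :
    IsBaerSecantTo q (lineAtInfinity K) (parabolaSubplane F t hd) :=
  (isBaerSecantTo_affinity_smul _).2 (isBaerSecantTo_subplaneOver hK hF)

theorem isCPlane_parabolaSubplane (hK : Nat.card K = q ^ 2) (hF : (F : Set K).encard = q)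
    (t : K) {d : K} (hd : d ≠ 0) :
    IsCPlane q (lineAtInfinity K) (affineParabola K) (parabolaSubplane F t hd) := by
  refine ⟨isBaerSecantTo_parabolaSubplane hK hF t hd, ?_⟩
  have hset : parabolaSubplane F t hd ∩ affineParabola K =
      (fun s => affinePoint (t + s * d) ((t + s * d) ^ 2)) '' (F : Set K) := by
    ext P
    rw [Set.mem_inter_iff, mem_affineParabola_iff]
    constructor
    · rintro ⟨hP, r, rfl⟩
      refine ⟨(r - t) / d, ((affinePoint_mem_parabolaSubplane hd).1 hP).1, ?_⟩
      have : t + (r - t) / d * d = r := by field_simp; ring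
      simp only [this]
    · rintro ⟨s, hs, rfl⟩
      refine ⟨(affinePoint_mem_parabolaSubplane hd).2 ⟨?_, by simp⟩, _, rfl⟩
      have : (t + s * d - t) / d = s := by field_simp; ring
      rwa [this]
  rw [hset, Function.Injective.encard_image, hF]
  intro a b hab
  have := (affinePoint_inj.1 hab).1
  exact mul_right_cancel₀ hd (add_left_cancel this)

end CPlanes

/-! ### Subplanes with five points on the parabola -/

section FivePoints

variable {K : Type*} [Field K] {F : Subfield K} {q : ℕ}

theorem eq_zero_of_add_mul_eq_zero {s a b : K} (hs : s ∉ F) (ha : a ∈ F) (hb : b ∈ F)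
    (h : a + b * s = 0) : a = 0 ∧ b = 0 := by
  have hb0 : b = 0 := by
    by_contra hb0
    refine hs ?_
    have : s = -a / b := by
      rw [eq_div_iff hb0]
      linear_combination h
    rw [this]
    exact F.div_mem (F.neg_mem ha) hb
  exact ⟨by simpa [hb0] using h, hb0⟩

/-- Over a subfield of order `q` of a field of order `q²`, any element outside of the subfield
forms a basis together with `1`. -/
theorem exists_eq_add_mul [Finite K] (hK : Nat.card K = q ^ 2) (hF : (F : Set K).encard = q)
    {s : K} (hs : s ∉ F) (z : K) : ∃ a ∈ F, ∃ b ∈ F, z = a + b * s := by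
  have hcard : Nat.card F = q := by
    have : (F : Set K).ncard = q := by rw [Set.ncard, hF]; rfl
    rwa [← Nat.card_coe_set_eq] at this
  let f : F × F → K := fun x => x.1 + x.2 * s
  have hf : Function.Injective f := by
    rintro ⟨a, b⟩ ⟨a', b'⟩ h
    have h' : (a + b * s : K) = a' + b' * s := h
    obtain ⟨h1, h2⟩ := eq_zero_of_add_mul_eq_zero (a := (a : K) - a') (b := (b : K) - b') hs
      (F.sub_mem a.2 a'.2) (F.sub_mem b.2 b'.2) (by linear_combination h')
    rw [sub_eq_zero] at h1 h2
    rw [Subtype.ext h1, Subtype.ext h2]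
  have hbij := hf.bijective_of_nat_card_le (by rw [Nat.card_prod, hcard, hK, sq])
  obtain ⟨⟨a, b⟩, rfl⟩ := hbij.2 z
  exact ⟨a, a.2, b, b.2, rfl⟩

/-- The affine Baer subplane with origin `(0, 0)` and basis `(1, 1)`, `(s, s²)` contains, if `s` is
not in the subfield, at most one further point of the parabola: in the basis `1`, `s` the condition
`(a + b * s) ^ 2 = a + b * s ^ 2` becomes two equations over the subfield, of which one expresses
`a` by `b` and the other one then is linear in `b`. -/
theorem eq_of_sq_eq_of_notMem [Finite K] (h2 : (2 : K) ≠ 0) (hK : Nat.card K = q ^ 2)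
    (hF : (F : Set K).encard = q) {s : K} (hs : s ∉ F) {a b a' b' : K} (ha : a ∈ F) (hb : b ∈ F)
    (ha' : a' ∈ F) (hb' : b' ∈ F) (h : (a + b * s) ^ 2 = a + b * s ^ 2)
    (h' : (a' + b' * s) ^ 2 = a' + b' * s ^ 2)
    (h0 : a + b * s ≠ 0) (h1 : a + b * s ≠ 1) (hs' : a + b * s ≠ s)
    (h0' : a' + b' * s ≠ 0) (h1' : a' + b' * s ≠ 1) (hs'' : a' + b' * s ≠ s) :
    a + b * s = a' + b' * s := by
  obtain ⟨N, hN, T, hT, hNT⟩ := exists_eq_add_mul hK hF hs (s ^ 2)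
  have h2F : (2 : K) ∈ F := ofNat_mem F 2
  have key {a b : K} (ha : a ∈ F) (hb : b ∈ F) (h : (a + b * s) ^ 2 = a + b * s ^ 2)
      (h0 : a + b * s ≠ 0) (h1 : a + b * s ≠ 1) (hs' : a + b * s ≠ s) :
      2 * a = (1 - b) * T ∧ b * (T ^ 2 + 4 * N) = T ^ 2 - 2 * T := by
    obtain ⟨e1, e2⟩ := eq_zero_of_add_mul_eq_zero (a := a * a - a + (b * b - b) * N)
      (b := b * (2 * a + (b - 1) * T)) hs
      (F.add_mem (F.sub_mem (F.mul_mem ha ha) ha)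
        (F.mul_mem (F.sub_mem (F.mul_mem hb hb) hb) hN))
      (F.mul_mem hb (F.add_mem (F.mul_mem h2F ha) (F.mul_mem (F.sub_mem hb F.one_mem) hT)))
      (by linear_combination h - (b * b - b) * hNT)
    have hb0 : b ≠ 0 := by
      rintro rfl
      have : a * (a - 1) = 0 := by linear_combination e1
      rcases mul_eq_zero.1 this with rfl | h
      · simp at h0
      · exact h1 (by linear_combination h)
    have e3 := (mul_eq_zero.1 e2).resolve_left hb0
    have hb1 : 1 - b ≠ 0 := by
      intro hb1
      obtain rfl : b = 1 := by linear_combination -hb1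
      have : a = 0 := by
        apply mul_left_cancel₀ h2
        linear_combination e3
      simp [this] at hs'
    refine ⟨by linear_combination e3, ?_⟩
    apply mul_left_cancel₀ hb1
    linear_combination -4 * e1 + (2 * a - 2 - (b - 1) * T) * e3
  obtain ⟨e1, e2⟩ := key ha hb h h0 h1 hs'
  obtain ⟨e1', e2'⟩ := key ha' hb' h' h0' h1' hs''
  have hdisc : T ^ 2 + 4 * N ≠ 0 := by
    intro hdisc
    have : (2 * s - T) ^ 2 = 0 := by linear_combination 4 * hNT + hdisc
    have : s = T / 2 := by
      rw [eq_div_iff h2]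
      linear_combination pow_eq_zero_iff two_ne_zero |>.1 this
    exact hs (this ▸ F.div_mem hT h2F)
  have hbb : b = b' := by
    apply mul_right_cancel₀ hdisc
    rw [e2, e2']
  subst hbb
  have haa : a = a' := by
    apply mul_left_cancel₀ h2
    rw [e1, e1']
  rw [haa]

/-- A Baer subplane secant to the line at infinity with five points on the parabola, among them
`(0, 0)` and `(1, 1)`, is the subplane over the subfield of order `q`. -/
theorem IsBaerSecantTo.eq_subplaneOver_of_five [Finite K] (h2 : (2 : K) ≠ 0)
    (hK : Nat.card K = q ^ 2) (hF : (F : Set K).encard = q) {B : Set (PGPoint K)}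
    (hB : IsBaerSecantTo q (lineAtInfinity K) B) (h0 : affinePoint 0 0 ∈ B)
    (h1 : affinePoint 1 1 ∈ B) {s r r' : K} (hs : affinePoint s (s ^ 2) ∈ B)
    (hr : affinePoint r (r ^ 2) ∈ B) (hr' : affinePoint r' (r' ^ 2) ∈ B) (hs0 : s ≠ 0) (hs1 : s ≠ 1)
    (hr0 : r ≠ 0) (hr1 : r ≠ 1) (hr0' : r' ≠ 0) (hr1' : r' ≠ 1) (hrs : r ≠ s) (hrs' : r' ≠ s)
    (hrr' : r ≠ r') : B = subplaneOver F := by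
  have hq : 1 < q := by
    have : 1 < q ^ 2 := hK ▸ Finite.one_lt_card
    by_contra hq
    exact absurd this (not_lt.2 (pow_le_one₀ (Nat.zero_le q) (not_lt.1 hq)))
  have hs1' : s - 1 ≠ 0 := sub_ne_zero.2 hs1
  have hdet : 1 * s ^ 2 - s * 1 ≠ 0 := by
    have : 1 * s ^ 2 - s * 1 = s * (s - 1) := by ring
    rw [this]
    exact mul_ne_zero hs0 hs1'
  set g := affinity 0 0 1 1 s (s ^ 2) hdet with hg
  obtain ⟨B', rfl⟩ : ∃ B', B = g • B' := ⟨g⁻¹ • B, by simp⟩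
  have hB' : B' = subplaneOver F := by
    refine IsBaerSecantTo.eq_subplaneOver hq hF ((isBaerSecantTo_affinity_smul hdet).1 hB) ?_ ?_ ?_
    · rw [← Set.smul_mem_smul_set_iff (a := g), hg, affinity_smul_affinePoint]
      simpa using h0
    · rw [← Set.smul_mem_smul_set_iff (a := g), hg, affinity_smul_affinePoint]
      simpa using h1
    · rw [← Set.smul_mem_smul_set_iff (a := g), hg, affinity_smul_affinePoint]
      simpa using hs
  subst hB'
  have hsF : s ∈ F := by
    by_contra hsF
    obtain ⟨a, b, hab, e1, e2⟩ := (affinePoint_mem_affinity_smul hdet).1 hr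
    obtain ⟨a', b', hab', e1', e2'⟩ := (affinePoint_mem_affinity_smul hdet).1 hr'
    rw [affinePoint_mem_subplaneOver] at hab hab'
    rw [mul_one, zero_add] at e1 e2 e1' e2'
    rw [e1] at e2 hr0 hr1 hrs hrr'
    rw [e1'] at e2' hr0' hr1' hrs' hrr'
    exact hrr' (eq_of_sq_eq_of_notMem h2 hK hF hsF hab.1 hab.2 hab'.1 hab'.2 e2 e2' hr0 hr1 hrs
      hr0' hr1' hrs')
  have hs1F : s - 1 ∈ F := F.sub_mem hsF F.one_mem
  refine IsBaerSecantTo.eq_subplaneOver hq hF hB h0 ?_ ?_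
  · refine (affinePoint_mem_affinity_smul hdet).2 ⟨s / (s - 1), -1 / (s * (s - 1)), ?_, ?_, ?_⟩
    · exact affinePoint_mem_subplaneOver.2 ⟨F.div_mem hsF hs1F,
        F.div_mem (F.neg_mem F.one_mem) (F.mul_mem hsF hs1F)⟩
    · field_simp; ring
    · field_simp; ring
  · refine (affinePoint_mem_affinity_smul hdet).2 ⟨-1 / (s - 1), 1 / (s * (s - 1)), ?_, ?_, ?_⟩
    · exact affinePoint_mem_subplaneOver.2 ⟨F.div_mem (F.neg_mem F.one_mem) hs1F,
        F.div_mem F.one_mem (F.mul_mem hsF hs1F)⟩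
    · field_simp; ring
    · field_simp; ring

/-- A Baer subplane secant to the line at infinity with more than four points on the parabola is
determined by any two of these points. -/
theorem IsBaerSecantTo.eq_parabolaSubplane [Finite K] (h2 : (2 : K) ≠ 0)
    (hK : Nat.card K = q ^ 2) (hF : (F : Set K).encard = q) {B : Set (PGPoint K)}
    (hB : IsBaerSecantTo q (lineAtInfinity K) B) (h4 : 4 < (B ∩ affineParabola K).encard)
    {t d : K} (hd : d ≠ 0) (ht : affinePoint t (t ^ 2) ∈ B)
    (htd : affinePoint (t + d) ((t + d) ^ 2) ∈ B) : B = parabolaSubplane F t hd := by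
  obtain ⟨B, rfl⟩ : ∃ B', B = parabolaAffinity t hd • B' :=
    ⟨(parabolaAffinity t hd)⁻¹ • B, by simp⟩
  have hmem (s : K) : affinePoint (t + s * d) ((t + s * d) ^ 2) ∈ parabolaAffinity t hd • B ↔
      affinePoint s (s ^ 2) ∈ B := by
    rw [← Set.smul_mem_smul_set_iff (a := parabolaAffinity t hd) (x := affinePoint s (s ^ 2)),
      parabolaAffinity, affinity_smul_affinePoint]
    ring_nf
  -- the parameters of the points of the parabola in the transformed subplane
  set S := {s : K | affinePoint s (s ^ 2) ∈ B} with hS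
  have hcard : 4 < S.encard := by
    have : (parabolaAffinity t hd • B) ∩ affineParabola K =
        (fun s => affinePoint (t + s * d) ((t + s * d) ^ 2)) '' S := by
      ext P
      rw [Set.mem_inter_iff, mem_affineParabola_iff]
      constructor
      · rintro ⟨hP, r, rfl⟩
        have e : t + (r - t) / d * d = r := by field_simp; ring
        refine ⟨(r - t) / d, ?_, by simp only [e]⟩
        rwa [hS, Set.mem_ofPred_eq, ← hmem, e]
      · rintro ⟨s, hs, rfl⟩
        exact ⟨(hmem s).2 hs, _, rfl⟩
    rw [this] at h4
    exact h4.trans_le (Set.encard_image_le _ _)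
  have h0 : affinePoint (0 : K) 0 ∈ B := by simpa using (hmem 0).1 (by simpa using ht)
  have h1 : affinePoint (1 : K) 1 ∈ B := by simpa using (hmem 1).1 (by simpa using htd)
  have hcard' : 3 ≤ (S \ {0, 1}).encard := by
    by_contra! hlt
    have hle : (S \ {0, 1}).encard ≤ 2 := Order.le_of_lt_add_one (by rwa [two_add_one_eq_three])
    have h3 : S.encard ≤ (S \ {0, 1}).encard + ({0, 1} : Set K).encard :=
      Set.encard_le_encard_sdiff_add_encard _ _
    have h4 : S.encard ≤ 2 + 2 := h3.trans (add_le_add hle ((Set.encard_pair zero_ne_one).le))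
    exact absurd (hcard.trans_le h4) (by norm_num)
  obtain ⟨R, hRS, hR⟩ := Set.exists_subset_encard_eq hcard'
  obtain ⟨s, r, r', hsr, hsr', hrr', rfl⟩ := Set.encard_eq_three.1 hR
  have hs := hRS (show s ∈ ({s, r, r'} : Set K) by simp)
  have hr := hRS (show r ∈ ({s, r, r'} : Set K) by simp)
  have hr' := hRS (show r' ∈ ({s, r, r'} : Set K) by simp)
  simp only [Set.mem_sdiff, Set.mem_insert_iff, Set.mem_singleton_iff, not_or] at hs hr hr'
  rw [parabolaSubplane, ((isBaerSecantTo_affinity_smul _).1 hB).eq_subplaneOver_of_five h2 hK hF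
    h0 h1 hs.1 hr.1 hr'.1 hs.2.1 hs.2.2 hr.2.1 hr.2.2 hr'.2.1 hr'.2.2 hsr.symm hsr'.symm hrr']

end FivePoints

/-! ### Squares and the subfield -/

/-- The exponent in Euler's criterion for the field of order `q²`. -/
theorem card_div_two_eq {K : Type*} [Fintype K] {q : ℕ} (hq : Odd q) (hK : Fintype.card K = q ^ 2) :
    Fintype.card K / 2 = (q - 1) * ((q + 1) / 2) := by
  obtain ⟨k, rfl⟩ := hq
  have h1 : (2 * k + 1) ^ 2 = 2 * (2 * k * (k + 1)) + 1 := by ring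
  have h2 : (2 * k + 1 + 1) / 2 = k + 1 := by omega
  rw [hK, h1, h2, Nat.add_sub_cancel]
  omega

section Squares

variable {K : Type*} [Field K] {F : Subfield K} {q : ℕ}

theorem Subfield.mem_iff_pow_sub_one_eq (hq : 1 < q) (hF : (F : Set K).encard = q) {x : K}
    (hx : x ≠ 0) : x ∈ F ↔ x ^ (q - 1) = 1 := by
  rw [F.mem_iff_pow_eq hq hF, ← pow_sub_one_mul (by omega : q ≠ 0), mul_eq_right₀ hx]

variable [Fintype K]

/-- The elements of the subfield of order `q` are squares in the field of order `q²`. -/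
theorem Subfield.isSquare_of_mem (hq : 1 < q) (hodd : Odd q) (hK : Fintype.card K = q ^ 2)
    (hF : (F : Set K).encard = q) {x : K} (hx : x ∈ F) : IsSquare x := by
  rcases eq_or_ne x 0 with rfl | h0
  · exact IsSquare.zero
  rw [FiniteField.isSquare_iff (ringChar_ne_two_of_odd_card (hK ▸ hodd.pow)) h0,
    card_div_two_eq hodd hK, pow_mul, (F.mem_iff_pow_sub_one_eq hq hF h0).1 hx, one_pow]

/-- There is an element `w` whose square is a nonsquare of the subfield `F`:
`w ^ (q - 1) = -1`, and each `r` with `r ^ 2 ∈ F` satisfies `r ^ (q - 1) = ±1`, so that it lies in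
`F` or in `F * w`. -/
theorem Subfield.exists_sq_mem_notMem (hq : 1 < q) (hodd : Odd q) (hK : Fintype.card K = q ^ 2)
    (hF : (F : Set K).encard = q) :
    ∃ w, w ≠ 0 ∧ w ∉ F ∧ w ^ 2 ∈ F ∧ ∀ r, r ^ 2 ∈ F → r ∈ F ∨ r / w ∈ F := by
  have hchar := ringChar_ne_two_of_odd_card (K := K) (hK ▸ hodd.pow)
  obtain ⟨n, hn⟩ := FiniteField.exists_nonsquare hchar
  have hn0 : n ≠ 0 := by
    rintro rfl
    exact hn IsSquare.zero
  have hw : (n ^ ((q + 1) / 2)) ^ (q - 1) = -1 := by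
    rw [← pow_mul, mul_comm, ← card_div_two_eq hodd hK]
    exact (FiniteField.pow_dichotomy hchar hn0).resolve_left
      fun h => hn ((FiniteField.isSquare_iff hchar hn0).2 h)
  have hw0 : n ^ ((q + 1) / 2) ≠ 0 := pow_ne_zero _ hn0
  generalize n ^ ((q + 1) / 2) = w at hw hw0
  refine ⟨w, hw0, ?_, ?_, ?_⟩
  · rw [F.mem_iff_pow_sub_one_eq hq hF hw0, hw]
    exact Ring.neg_one_ne_one_of_char_ne_two hchar
  · rw [F.mem_iff_pow_sub_one_eq hq hF (pow_ne_zero 2 hw0), ← pow_mul, mul_comm, pow_mul, hw]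
    simp
  · intro r hr
    rcases eq_or_ne r 0 with rfl | hr0
    · exact .inl F.zero_mem
    rw [F.mem_iff_pow_sub_one_eq hq hF (pow_ne_zero 2 hr0), ← pow_mul, mul_comm, pow_mul,
      sq_eq_one_iff] at hr
    rcases hr with hr | hr
    · exact .inl ((F.mem_iff_pow_sub_one_eq hq hF hr0).2 hr)
    · refine .inr ((F.mem_iff_pow_sub_one_eq hq hF (div_ne_zero hr0 hw0)).2 ?_)
      rw [div_pow, hr, hw, div_self (neg_ne_zero.2 one_ne_zero)]

end Squares

/-! ### The subplanes through an affine point -/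

section CPlanesThroughPoints

variable {K : Type*} [Field K] [Finite K] {F : Subfield K} {q : ℕ}

theorem IsCPlane.eq_parabolaSubplane (h2 : (2 : K) ≠ 0) (hq : 4 < q) (hK : Nat.card K = q ^ 2)
    (hF : (F : Set K).encard = q) {B : Set (PGPoint K)}
    (hB : IsCPlane q (lineAtInfinity K) (affineParabola K) B) {t d : K} (hd : d ≠ 0)
    (ht : affinePoint t (t ^ 2) ∈ B) (htd : affinePoint (t + d) ((t + d) ^ 2) ∈ B) :
    B = parabolaSubplane F t hd :=
  hB.1.eq_parabolaSubplane h2 hK hF (by rw [hB.2]; exact_mod_cast hq) hd ht htd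

theorem parabolaSubplane_eq_iff (h2 : (2 : K) ≠ 0) (hq : 4 < q) (hK : Nat.card K = q ^ 2)
    (hF : (F : Set K).encard = q) {t d d' : K} (hd : d ≠ 0) (hd' : d' ≠ 0) :
    parabolaSubplane F t hd = parabolaSubplane F t hd' ↔ d / d' ∈ F := by
  constructor
  · intro h
    have : affinePoint (t + d) ((t + d) ^ 2) ∈ parabolaSubplane F t hd :=
      (affinePoint_mem_parabolaSubplane hd).2 (by simp [hd])
    rw [h, affinePoint_mem_parabolaSubplane] at this
    simpa using this.1
  · intro h
    refine ((isCPlane_parabolaSubplane hK hF t hd').eq_parabolaSubplane h2 hq hK hF hd ?_ ?_).symm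
    · simp [affinePoint_mem_parabolaSubplane]
    · simpa [affinePoint_mem_parabolaSubplane] using h

/-- The subplanes through an affine point may be described with the abscissa of that point as the
base parameter. -/
theorem isCPlane_and_affinePoint_mem_iff (h2 : (2 : K) ≠ 0) (hq : 4 < q) (hK : Nat.card K = q ^ 2)
    (hF : (F : Set K).encard = q) {B : Set (PGPoint K)} {x y : K} :
    IsCPlane q (lineAtInfinity K) (affineParabola K) B ∧ affinePoint x y ∈ B ↔
      ∃ (d : K) (hd : d ≠ 0), (y - x ^ 2) / d ^ 2 ∈ F ∧ B = parabolaSubplane F x hd := by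
  constructor
  · rintro ⟨hB, hxy⟩
    have h1 : 1 < (B ∩ affineParabola K).encard := by
      rw [hB.2]
      exact_mod_cast (by omega : 1 < q)
    obtain ⟨P, hP, Q, hQ, hPQ⟩ := Set.one_lt_encard_iff_nontrivial.1 h1
    obtain ⟨s, rfl⟩ := mem_affineParabola_iff.1 hP.2
    obtain ⟨t, rfl⟩ := mem_affineParabola_iff.1 hQ.2
    have hd : t - s ≠ 0 := sub_ne_zero.2 fun h => hPQ (by rw [h])
    have hBs : B = parabolaSubplane F s hd :=
      hB.eq_parabolaSubplane h2 hq hK hF hd hP.1 (by simpa using hQ.1)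
    rw [hBs, affinePoint_mem_parabolaSubplane] at hxy
    refine ⟨t - s, hd, hxy.2, ?_⟩
    refine hB.eq_parabolaSubplane h2 hq hK hF hd ?_ ?_
    · rw [hBs, affinePoint_mem_parabolaSubplane]
      exact ⟨hxy.1, by simp⟩
    · rw [hBs, affinePoint_mem_parabolaSubplane]
      refine ⟨?_, by simp⟩
      have : (x + (t - s) - s) / (t - s) = (x - s) / (t - s) + 1 := by field_simp; ring
      rw [this]
      exact F.add_mem hxy.1 F.one_mem
  · rintro ⟨d, hd, h, rfl⟩
    exact ⟨isCPlane_parabolaSubplane hK hF x hd,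
      (affinePoint_mem_parabolaSubplane hd).2 ⟨by simp, h⟩⟩

theorem existsUnique_isCPlane (h2 : (2 : K) ≠ 0) (hq : 4 < q) (hK : Nat.card K = q ^ 2)
    (hF : (F : Set K).encard = q) {P Q : PGPoint K} (hP : P ∈ affineParabola K)
    (hQ : Q ∈ affineParabola K) (hPQ : P ≠ Q) :
    ∃! B, IsCPlane q (lineAtInfinity K) (affineParabola K) B ∧ P ∈ B ∧ Q ∈ B := by
  obtain ⟨s, rfl⟩ := mem_affineParabola_iff.1 hP
  obtain ⟨t, rfl⟩ := mem_affineParabola_iff.1 hQ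
  have hd : t - s ≠ 0 := sub_ne_zero.2 fun h => hPQ (by rw [h])
  refine ⟨parabolaSubplane F s hd, ⟨isCPlane_parabolaSubplane hK hF s hd, ?_, ?_⟩, ?_⟩
  · simp [affinePoint_mem_parabolaSubplane]
  · simp [affinePoint_mem_parabolaSubplane, hd]
  · rintro B ⟨hB, hs, ht⟩
    exact hB.eq_parabolaSubplane h2 hq hK hF hd hs (by simpa using ht)

end CPlanesThroughPoints

section Exterior

variable {K : Type*} [Field K] [Fintype K] {F : Subfield K} {q : ℕ}

theorem isInteriorPoint_iff_forall_isCPlane (h2 : (2 : K) ≠ 0) (hq : 4 < q) (hodd : Odd q)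
    (hK : Fintype.card K = q ^ 2) (hF : (F : Set K).encard = q) (x y : K) :
    IsInteriorPoint (parabola K) (affinePoint x y) ↔
      ∀ B, IsCPlane q (lineAtInfinity K) (affineParabola K) B → affinePoint x y ∉ B := by
  have hK' : Nat.card K = q ^ 2 := by rw [Nat.card_eq_fintype_card, hK]
  have hq1 : 1 < q := by omega
  rw [isInteriorPoint_parabola_iff, ← not_iff_not, not_not]
  push Not
  constructor
  · rintro ⟨r, hr⟩
    have : ∃ (d : K) (_ : d ≠ 0), (y - x ^ 2) / d ^ 2 ∈ F := by
      rcases eq_or_ne r 0 with rfl | hr0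
      · refine ⟨1, one_ne_zero, ?_⟩
        have : y - x ^ 2 = 0 := by linear_combination -hr
        simp [this]
      · refine ⟨r, hr0, ?_⟩
        have : (y - x ^ 2) / r ^ 2 = -1 := by
          rw [div_eq_iff (pow_ne_zero 2 hr0)]
          linear_combination -hr
        rw [this]
        exact F.neg_mem F.one_mem
    obtain ⟨d, hd, h⟩ := this
    exact ⟨_, (isCPlane_and_affinePoint_mem_iff h2 hq hK' hF).2 ⟨d, hd, h, rfl⟩⟩
  · rintro ⟨B, hB⟩
    obtain ⟨d, hd, h, -⟩ := (isCPlane_and_affinePoint_mem_iff h2 hq hK' hF).1 hB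
    obtain ⟨r, hr⟩ := Subfield.isSquare_of_mem hq1 hodd hK hF (F.neg_mem h)
    refine ⟨r * d, ?_⟩
    have e : -(y - x ^ 2) = r * r * d ^ 2 := by
      rw [← hr]
      field_simp
    linear_combination e

theorem isExteriorPoint_iff_encard_isCPlane (h2 : (2 : K) ≠ 0) (hq : 4 < q) (hodd : Odd q)
    (hK : Fintype.card K = q ^ 2) (hF : (F : Set K).encard = q) (x y : K) :
    IsExteriorPoint (parabola K) (affinePoint x y) ↔
      {B | IsCPlane q (lineAtInfinity K) (affineParabola K) B ∧ affinePoint x y ∈ B}.encard =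
        2 := by
  have hK' : Nat.card K = q ^ 2 := by rw [Nat.card_eq_fintype_card, hK]
  have hq1 : 1 < q := by omega
  obtain ⟨w, hw0, hwF, hw2, hw⟩ := Subfield.exists_sq_mem_notMem hq1 hodd hK hF
  simp only [isCPlane_and_affinePoint_mem_iff h2 hq hK' hF]
  rw [isExteriorPoint_parabola_iff h2]
  constructor
  · rintro ⟨r, hr0, hr⟩
    have hrw0 : r * w ≠ 0 := mul_ne_zero hr0 hw0
    have hset : {B | ∃ (d : K) (hd : d ≠ 0), (y - x ^ 2) / d ^ 2 ∈ F ∧ B = parabolaSubplane F x hd}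
        = {parabolaSubplane F x hr0, parabolaSubplane F x hrw0} := by
      ext B
      rw [Set.mem_ofPred_eq, Set.mem_insert_iff, Set.mem_singleton_iff]
      constructor
      · rintro ⟨d, hd, h, rfl⟩
        have hdr : (d / r) ^ 2 ∈ F := by
          have : (d / r) ^ 2 = -((y - x ^ 2) / d ^ 2)⁻¹ := by
            have : y - x ^ 2 = -r ^ 2 := by linear_combination -hr
            rw [this]
            field_simp
          rw [this]
          exact F.neg_mem (F.inv_mem h)
        rw [parabolaSubplane_eq_iff h2 hq hK' hF, parabolaSubplane_eq_iff h2 hq hK' hF, ← div_div]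
        exact hw _ hdr
      · have hyx : y - x ^ 2 = -r ^ 2 := by linear_combination -hr
        rintro (rfl | rfl)
        · refine ⟨r, hr0, ?_, rfl⟩
          have : (y - x ^ 2) / r ^ 2 = -1 := by
            rw [hyx]
            field_simp
          rw [this]
          exact F.neg_mem F.one_mem
        · refine ⟨r * w, hrw0, ?_, rfl⟩
          have : (y - x ^ 2) / (r * w) ^ 2 = -(w ^ 2)⁻¹ := by
            rw [hyx]
            field_simp
          rw [this]
          exact F.neg_mem (F.inv_mem hw2)
    rw [hset, Set.encard_pair]
    rw [Ne, eq_comm, parabolaSubplane_eq_iff h2 hq hK' hF]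
    rwa [mul_div_cancel_left₀ _ hr0]
  · intro h
    obtain ⟨B, d, hd, hdF, -⟩ : {B | ∃ (d : K) (hd : d ≠ 0), (y - x ^ 2) / d ^ 2 ∈ F ∧
        B = parabolaSubplane F x hd}.Nonempty := by
      rw [← Set.encard_ne_zero, h]
      simp
    obtain ⟨r, hr⟩ := Subfield.isSquare_of_mem hq1 hodd hK hF (F.neg_mem hdF)
    have e : x ^ 2 - y = (r * d) ^ 2 := by
      have : -(y - x ^ 2) = r * r * d ^ 2 := by
        rw [← hr]
        field_simp
      linear_combination this
    refine ⟨r * d, ?_, e⟩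
    intro h0
    -- a point of the parabola is on the three subplanes with the directions `1`, `w` and `1 + w`
    have hyx : y - x ^ 2 = 0 := by rw [h0] at e; linear_combination -e
    have hw1 : 1 + w ≠ 0 := by
      intro h
      refine hwF ?_
      have : w = -1 := by linear_combination h
      rw [this]
      exact F.neg_mem F.one_mem
    have hsub : {parabolaSubplane F x one_ne_zero, parabolaSubplane F x hw0,
        parabolaSubplane F x hw1} ⊆
        {B | ∃ (d : K) (hd : d ≠ 0), (y - x ^ 2) / d ^ 2 ∈ F ∧ B = parabolaSubplane F x hd} := by
      rintro B (rfl | rfl | rfl)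
      · exact ⟨_, _, by simp [hyx], rfl⟩
      · exact ⟨_, _, by simp [hyx], rfl⟩
      · exact ⟨_, _, by simp [hyx], rfl⟩
    have hle := Set.encard_le_encard hsub
    rw [h, Set.encard_eq_three.2 ⟨_, _, _, ?_, ?_, ?_, rfl⟩] at hle
    · exact absurd hle (by norm_num)
    · rw [Ne, eq_comm, parabolaSubplane_eq_iff h2 hq hK' hF, div_one]
      exact hwF
    · rw [Ne, eq_comm, parabolaSubplane_eq_iff h2 hq hK' hF, div_one]
      exact fun h => hwF (by simpa using F.sub_mem h F.one_mem)
    · rw [Ne, eq_comm, parabolaSubplane_eq_iff h2 hq hK' hF, add_div, div_self hw0]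
      exact fun h => hwF (by simpa using F.inv_mem (F.sub_mem h F.one_mem))

end Exterior

theorem lemma1p1 {K : Type*} [Field K] [Fintype K] (q : ℕ) (hq : Odd q)
    (hK : Fintype.card K = q ^ 2)
    (conic linf : Set (PGPoint K)) (Pinf : PGPoint K)
    (hconic : IsNondegenerateConic conic)
    (htangent : IsTangentAt conic linf Pinf)
    (C : Set (PGPoint K)) (hC : C = conic \ {Pinf}) :
    -- Part 1
    ((∀ B : Set (PGPoint K), IsCPlane q linf C B → IsArc q (B ∩ C)) ∧
      (∀ B : Set (PGPoint K), IsBaerSecantTo q linf B → 4 < (B ∩ C).encard →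
        IsCPlane q linf C B)) ∧
    (q ≠ 3 →
      -- Part 2
      (∀ P ∈ C, ∀ Q ∈ C, P ≠ Q →
        ∃! B : Set (PGPoint K), IsCPlane q linf C B ∧ P ∈ B ∧ Q ∈ B) ∧
      -- Part 3: each affine point is a point of C, an interior point or an exterior point;
      -- the interior ones are those on no C-plane, the exterior ones those on exactly two
      (∀ X : PGPoint K, X ∉ linf →
        (X ∈ C ∨ IsInteriorPoint conic X ∨ IsExteriorPoint conic X) ∧
        (IsInteriorPoint conic X ↔ ∀ B : Set (PGPoint K), IsCPlane q linf C B → X ∉ B) ∧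
        (IsExteriorPoint conic X ↔
          {B : Set (PGPoint K) | IsCPlane q linf C B ∧ X ∈ B}.encard = 2))) := by
  have hK' : Nat.card K = q ^ 2 := by rw [Nat.card_eq_fintype_card, hK]
  have h2 : (2 : K) ≠ 0 := Ring.two_ne_zero (ringChar_ne_two_of_odd_card (hK ▸ hq.pow))
  obtain ⟨F, hF⟩ := exists_subfield_encard_eq hK
  obtain ⟨g, rfl, rfl, rfl⟩ := exists_smul_parabola hconic htangent
  have hC' : C = g • affineParabola K := by
    rw [hC, affineParabola, Set.smul_set_sdiff, Set.smul_set_singleton]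
  clear hC
  subst hC'
  have hpt (X : PGPoint K) : ∃ Y, X = g • Y := ⟨g⁻¹ • X, by simp⟩
  have hset (B : Set (PGPoint K)) : ∃ B', B = g • B' := ⟨g⁻¹ • B, by simp⟩
  refine ⟨⟨?_, ?_⟩, fun hq3 => ?_⟩
  · intro B hB
    have hfin : (B ∩ g • affineParabola K).Finite := Set.finite_of_encard_eq_coe hB.2
    refine ⟨hfin, ?_, ?_⟩
    · rw [Set.ncard, hB.2, ENat.toNat_natCast]
    · rintro X ⟨-, X, hX, rfl⟩ Y ⟨-, Y, hY, rfl⟩ Z ⟨-, Z, hZ, rfl⟩ hXY hXZ hYZ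
      rw [areCollinear_smul]
      exact not_areCollinear_of_mem_affineParabola hX hY hZ (fun h => hXY (by rw [h]))
        (fun h => hXZ (by rw [h])) (fun h => hYZ (by rw [h]))
  · intro B hB h4
    obtain ⟨B, rfl⟩ := hset B
    rw [isBaerSecantTo_smul] at hB
    rw [← Set.smul_set_inter, Set.encard_smul_set] at h4
    rw [isCPlane_smul]
    have h1 : 1 < (B ∩ affineParabola K).encard := lt_trans (by norm_num) h4
    obtain ⟨P, hP, Q, hQ, hPQ⟩ := Set.one_lt_encard_iff_nontrivial.1 h1
    obtain ⟨s, rfl⟩ := mem_affineParabola_iff.1 hP.2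
    obtain ⟨t, rfl⟩ := mem_affineParabola_iff.1 hQ.2
    have hd : t - s ≠ 0 := sub_ne_zero.2 fun h => hPQ (by rw [h])
    rw [hB.eq_parabolaSubplane h2 hK' hF h4 hd hP.1 (by simpa using hQ.1)]
    exact isCPlane_parabolaSubplane hK' hF s hd
  · have hq4 : 4 < q := by
      have hq1 : q ≠ 1 := by
        rintro rfl
        exact absurd hK (Fintype.one_lt_card (α := K)).ne'
      obtain ⟨k, rfl⟩ := hq
      omega
    refine ⟨?_, ?_⟩
    · rintro _ ⟨P, hP, rfl⟩ _ ⟨Q, hQ, rfl⟩ hPQ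
      obtain ⟨B, ⟨hB, hPB, hQB⟩, huniq⟩ :=
        existsUnique_isCPlane h2 hq4 hK' hF hP hQ fun h => hPQ (by rw [h])
      refine ⟨g • B, ⟨(isCPlane_smul g).2 hB, Set.smul_mem_smul_set hPB,
        Set.smul_mem_smul_set hQB⟩, ?_⟩
      rintro B' ⟨hB', hPB', hQB'⟩
      obtain ⟨B', rfl⟩ := hset B'
      rw [huniq B' ⟨(isCPlane_smul g).1 hB', Set.smul_mem_smul_set_iff.1 hPB',
        Set.smul_mem_smul_set_iff.1 hQB'⟩]
    · intro X hX
      obtain ⟨X, rfl⟩ := hpt X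
      rw [Set.smul_mem_smul_set_iff] at hX
      obtain ⟨x, y, rfl⟩ := exists_affinePoint hX
      rw [isInteriorPoint_smul, isExteriorPoint_smul, Set.smul_mem_smul_set_iff]
      refine ⟨?_, ?_, ?_⟩
      · rw [affinePoint_mem_affineParabola, isInteriorPoint_parabola_iff,
          isExteriorPoint_parabola_iff h2]
        by_cases hsq : IsSquare (x ^ 2 - y)
        · obtain ⟨r, hr⟩ := hsq
          rcases eq_or_ne r 0 with rfl | hr0
          · left
            linear_combination -hr
          · exact .inr (.inr ⟨r, hr0, by rw [hr, sq]⟩)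
        · exact .inr (.inl hsq)
      · rw [isInteriorPoint_iff_forall_isCPlane h2 hq4 hq hK hF]
        constructor
        · intro h B hB hX
          obtain ⟨B, rfl⟩ := hset B
          exact h B ((isCPlane_smul g).1 hB) (Set.smul_mem_smul_set_iff.1 hX)
        · intro h B hB hX
          exact h (g • B) ((isCPlane_smul g).2 hB) (Set.smul_mem_smul_set hX)
      · rw [isExteriorPoint_iff_encard_isCPlane h2 hq4 hq hK hF]
        have : {B | IsCPlane q (g • lineAtInfinity K) (g • affineParabola K) B ∧
            g • affinePoint x y ∈ B} = g • {B | IsCPlane q (lineAtInfinity K) (affineParabola K) B ∧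
            affinePoint x y ∈ B} := by
          ext B
          obtain ⟨B, rfl⟩ := hset B
          rw [Set.smul_mem_smul_set_iff, Set.mem_ofPred_eq, Set.mem_ofPred_eq, isCPlane_smul,
            Set.smul_mem_smul_set_iff]
        rw [this, Set.encard_smul_set]
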